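/- Positions are finite Hackenbush positions: graphs with blue, red and green edges (loops and multiple edges allowed) in which some vertices are on the ground. Left may cut blue or green edges, Right may cut red or green edges, and after each cut the edges no longer connected to the ground disappear. Under normal play a player who cannot move loses, under misère play a player who cannot move wins. The outcomes $o^+(G)$ (normal play) and $o^-(G)$ (misère play) are $\mathcal N$ (the player moving first wins), $\mathcal P$ (the player moving second wins), $\mathcal L$ (Left wins, whoever starts) or $\mathcal R$ (Right wins, whoever starts). The sum of positions is the disjoint union. A Stalk of height $h\ge 1$ is a green path of $h$ edges with one end on the ground, and $*$ is the Stalk of height $1$. The value of a red-blue position (one without green edges) is, recursively, the simplest dyadic rational strictly between the values of its left options and the values of its right options (smallest denominator, then smallest absolute value). A Generalized Sprig $*:B$ is a single green edge from the ground supporting a red-blue position $B$, whose ground is placed at the top of that edge; $*:(x)$ denotes any Generalized Sprig for which $B$ has value $x$. Theorem. Let $m,n\ge 0$ and $$G=\sum_{i=1}^m *:(x_i)+\sum_{j=1}^n *:(-y_j)+A,$$ where all $x_i>0$, all $y_j>0$, and $A$ is a (possibly empty) sum of Stalks. Let $a$ be the nim-sum (bitwise exclusive or) of the heights of these Stalks,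 and let $\Delta=m-n$. Let $\varepsilon$ be defined as follows: cancel pairs $x_i=y_j$ one for one until no such pair is left, and put $\varepsilon=\min x_i-\min y_j$ over the remaining $x_i$ and $y_j$, or $\varepsilon=0$ if no $x_i$ or no $y_j$ remains. Let $G^*=G$ if some Stalk in $A$ has height at least $2$, and $G^*=G+*$ otherwise. Then $o^+(G)=o^-(G^*)$, and this common outcome is as follows. (i) If $\Delta\ge 2$, it is $\mathcal L$; if $\Delta\le -2$, it is $\mathcal R$. (ii) If $\Delta=1$, it is $\mathcal N$ when $\varepsilon\le 0$ and $a=0$, and $\mathcal L$ when $a\ne 0$, or $\varepsilon>0$ and $a=0$. If $\Delta=-1$, it is $\mathcal N$ when $\varepsilon\ge 0$ and $a=0$, and $\mathcal R$ when $a\neq 0$, or $\varepsilon<0$ and $a=0$. (iii) If $\Delta=0$, it is $\mathcal N$ when $a\ne 0$; when $a=0$, it is $\mathcal P$ if $\varepsilon=0$, $\mathcal L$ if $\varepsilon>0$, and $\mathcal R$ if $\varepsilon<0$. -/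

import Mathlib

/-! ### Combinatorial games and their outcomes -/

/-- A combinatorial game (a position): a family of left options and a family of right options. -/
inductive CGame : Type 1 where
  | mk (α β : Type) (L : α → CGame) (R : β → CGame) : CGame

/-- The two players. -/
inductive Player : Type where
  | left
  | right

/-- The four outcome classes: Next-player win, Previous-player win, Left win, Right win. -/
inductive Outcome : Type where
  | N
  | P
  | L
  | R

namespace CGame

/-- Under normal play, the given player wins when moving first
(a player who cannot move loses). -/
def NormalWinsFirst : CGame → Player → Prop
  | mk _ _ L _, Player.left => ∃ i, ¬ NormalWinsFirst (L i) Player.right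
  | mk _ _ _ R, Player.right => ∃ j, ¬ NormalWinsFirst (R j) Player.left

/-- Under misère play, the given player wins when moving first
(a player who cannot move wins). -/
def MisereWinsFirst : CGame → Player → Prop
  | mk α _ L _, Player.left => IsEmpty α ∨ ∃ i, ¬ MisereWinsFirst (L i) Player.right
  | mk _ β _ R, Player.right => IsEmpty β ∨ ∃ j, ¬ MisereWinsFirst (R j) Player.left

end CGame

open scoped Classical in
/-- The outcome class, given whether Left wins moving first (`l`) and whether Right wins
moving first (`r`). -/
noncomputable def Outcome.ofWinners (l r : Prop) : Outcome :=
  if l then (if r then Outcome.N else Outcome.L) else (if r then Outcome.R else Outcome.P)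

/-- The normal-play outcome `o⁺`. -/
noncomputable def CGame.normalOutcome (G : CGame) : Outcome :=
  Outcome.ofWinners (G.NormalWinsFirst Player.left) (G.NormalWinsFirst Player.right)

/-- The misère-play outcome `o⁻`. -/
noncomputable def CGame.misereOutcome (G : CGame) : Outcome :=
  Outcome.ofWinners (G.MisereWinsFirst Player.left) (G.MisereWinsFirst Player.right)

/-! ### The number value of a game -/

/-- `x` is a dyadic rational, `x = a / 2 ^ b`. -/
def IsDyadic (x : ℚ) : Prop := ∃ b : ℕ, x.den = 2 ^ b

/-- `x` is the simplest dyadic rational that is larger than all elements of `A` and smaller than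
all elements of `B`: its denominator is as small as possible, and among those of this denominator
its absolute value is as small as possible (the second clause matters only for integers). -/
def IsSimplestBetween (A B : Set ℚ) (x : ℚ) : Prop :=
  (IsDyadic x ∧ (∀ a ∈ A, a < x) ∧ ∀ b ∈ B, x < b) ∧
    ∀ y : ℚ, IsDyadic y → (∀ a ∈ A, a < y) → (∀ b ∈ B, y < b) →
      x.den < y.den ∨ (x.den = y.den ∧ |x| ≤ |y|)

open scoped Classical in
/-- The normal-play value of a game that is a number: recursively, the simplest dyadic rational
strictly between the values of the left options and the values of the right options.
(The default `0` never occurs for finite red-blue Hackenbush positions.) -/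
noncomputable def CGame.value : CGame → ℚ
  | mk _ _ L R =>
    if h : ∃ x, IsSimplestBetween (Set.range fun i => (L i).value)
        (Set.range fun j => (R j).value) x
    then h.choose else 0

/-! ### Hackenbush -/

/-- Edge colours. Left may cut blue and green edges, Right may cut red and green edges. -/
inductive EdgeColor : Type where
  | blue
  | red
  | green

/-- A Hackenbush graph: a graph with finitely many coloured edges (loops and multiple edges
allowed), some of whose vertices are on the ground. -/
structure Hackenbush : Type 1 where
  V : Type
  E : Type
  finite_E : Finite E
  ends : E → Sym2 V
  color : E → EdgeColor
  ground : Set V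

namespace Hackenbush

/-- `v` is joined to the ground by a path of edges from `S`. -/
inductive Grounded (H : Hackenbush) (S : Set H.E) : H.V → Prop where
  | base {v : H.V} (hv : v ∈ H.ground) : Grounded H S v
  | step {u v : H.V} {e : H.E} (he : e ∈ S) (huv : H.ends e = s(u, v))
      (hu : Grounded H S u) : Grounded H S v

/-- The edges of `S` that are connected to the ground through `S`; the others fall off. -/
def prune (H : Hackenbush) (S : Set H.E) : Set H.E :=
  {e | e ∈ S ∧ ∃ v ∈ H.ends e, H.Grounded S v}

theorem ncard_prune_lt (H : Hackenbush) (S : Set H.E) {e : H.E} (he : e ∈ S) :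
    (H.prune (S \ {e})).ncard < S.ncard := by
  have := H.finite_E
  refine Set.ncard_lt_ncard ?_ S.toFinite
  refine ⟨fun f hf => hf.1.1, fun h => ?_⟩
  exact (h he).1.2 rfl

/-- The game played on the graph `H` when `S` is the set of remaining edges: a player cuts an edge
that he is allowed to cut, and the edges no longer connected to the ground are removed. -/
def gameOn (H : Hackenbush) (S : Set H.E) : CGame :=
  CGame.mk {e : H.E // e ∈ S ∧ H.color e ≠ EdgeColor.red}
    {e : H.E // e ∈ S ∧ H.color e ≠ EdgeColor.blue}
    (fun e => gameOn H (H.prune (S \ {e.1})))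
    (fun e => gameOn H (H.prune (S \ {e.1})))
termination_by S.ncard
decreasing_by
  · exact H.ncard_prune_lt S e.2.1
  · exact H.ncard_prune_lt S e.2.1

/-- The game of a Hackenbush graph (edges not connected to the ground do not count). -/
def toGame (H : Hackenbush) : CGame := H.gameOn (H.prune Set.univ)

/-- Red-blue Hackenbush: no green edges. -/
def IsRedBlue (H : Hackenbush) : Prop := ∀ e, H.color e ≠ EdgeColor.green

/-- The normal-play value of a (red-blue) Hackenbush position. -/
noncomputable def value (H : Hackenbush) : ℚ := H.toGame.value

/-- The empty position. -/
def empty : Hackenbush where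
  V := Empty
  E := Empty
  finite_E := inferInstance
  ends := fun e => e.elim
  color := fun e => e.elim
  ground := ∅

/-- The disjunctive sum: the disjoint union of the two graphs. -/
def add (G H : Hackenbush) : Hackenbush where
  V := G.V ⊕ H.V
  E := G.E ⊕ H.E
  finite_E := by
    have := G.finite_E
    have := H.finite_E
    infer_instance
  ends := Sum.elim (fun e => (G.ends e).map Sum.inl) (fun e => (H.ends e).map Sum.inr)
  color := Sum.elim G.color H.color
  ground := Sum.inl '' G.ground ∪ Sum.inr '' H.ground

/-- The disjunctive sum of a list of positions. -/
def sum (l : List Hackenbush) : Hackenbush := l.foldr add empty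

/-- The Stalk of height `h`: a green path with `h` edges, one end of which is on the ground. -/
def stalk (h : ℕ) : Hackenbush where
  V := Fin (h + 1)
  E := Fin h
  finite_E := inferInstance
  ends := fun i => s(i.castSucc, i.succ)
  color := fun _ => EdgeColor.green
  ground := {0}

/-- The game `*`. -/
def star : Hackenbush := stalk 1

/-- The vertices of a Generalized Sprig whose blossom has vertex set `V`: the two ends of the stem
and the vertices of the blossom. -/
inductive SprigVertex (V : Type) : Type where
  | root
  | top
  | inner (v : V)

open scoped Classical in
/-- The place of a blossom vertex in the Generalized Sprig: the ground of the blossom becomes the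
top of the stem. -/
noncomputable def sprigVertex (B : Hackenbush) (v : B.V) : SprigVertex B.V :=
  if v ∈ B.ground then SprigVertex.top else SprigVertex.inner v

/-- The Generalized Sprig `* : B`, a green edge (the edge `none`) supporting `B`. -/
noncomputable def sprig (B : Hackenbush) : Hackenbush where
  V := SprigVertex B.V
  E := Option B.E
  finite_E := by
    have := B.finite_E
    infer_instance
  ends := fun e => e.elim s(SprigVertex.root, SprigVertex.top)
    (fun e => (B.ends e).map B.sprigVertex)
  color := fun e => e.elim EdgeColor.green B.color
  ground := {SprigVertex.root}

end Hackenbush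

/-! ### Sums of Generalized Sprigs and Stalks -/

/-- A summand: a Generalized Sprig with a given blossom, or a Stalk of a given height. -/
inductive Summand : Type 1 where
  | sprig (B : Hackenbush) : Summand
  | stalk (h : ℕ) : Summand

namespace Summand

/-- The Hackenbush position of a summand. -/
noncomputable def position : Summand → Hackenbush
  | sprig B => B.sprig
  | stalk h => Hackenbush.stalk h

/-- The height of a summand (the length of its stem). -/
def height : Summand → ℕ
  | sprig _ => 1
  | stalk h => h

/-- The disjunctive sum `G` of a list of summands. -/
noncomputable def total (l : List Summand) : Hackenbush := Hackenbush.sum (l.map position)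

open scoped Classical in
/-- The evil twin `G*`: it is `G` if some summand has height at least `2`, and `G + *` if all
summands have height `1`. -/
noncomputable def evilTwin (l : List Summand) : Hackenbush :=
  if ∃ s ∈ l, 2 ≤ s.height then total l else (total l).add Hackenbush.star

end Summand

/-- The sum of the Generalized Sprigs with the blossoms in `Bs` and in `Cs` and the Stalks with the
heights in `hs`. -/
def sprigsAndStalks (Bs Cs : List Hackenbush) (hs : List ℕ) : List Summand :=
  Bs.map Summand.sprig ++ Cs.map Summand.sprig ++ hs.map Summand.stalk

/-- The nim-sum of a list of natural numbers (bitwise exclusive or). -/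
def nimSum (hs : List ℕ) : ℕ := hs.foldr (fun h a => h ^^^ a) 0

/-- `min x - min y`, or `0` if one of the two lists is empty. -/
def minDiff (x y : List ℚ) : ℚ :=
  match x.min?, y.min? with
  | some a, some b => a - b
  | _, _ => 0

/-- The edge for the blossom values `x₁, …, x_m` and `-y₁, …, -y_n`: cancel pairs `x_i = y_j`
one for one until none is left, and take `min x - min y` of what remains (`0` if one side is
empty). If no `x_i` equals a `y_j`, nothing is cancelled. -/
def edge (x y : List ℚ) : ℚ := minDiff (x.diff y) (y.diff x)

/-- Without pairs `x_i = y_j` the edge is `min x - min y`. -/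
theorem edge_eq_minDiff (x y : List ℚ) (h : ∀ a ∈ x, a ∉ y) : edge x y = minDiff x y := by
  have key : ∀ (l₂ l₁ : List ℚ), (∀ a ∈ l₁, a ∉ l₂) → l₁.diff l₂ = l₁ := by
    intro l₂
    induction l₂ with
    | nil => intro l₁ _; simp
    | cons b t ih =>
      intro l₁ hl
      have hb : b ∉ l₁ := fun hb => hl b hb (by simp)
      rw [List.diff_cons, List.erase_of_not_mem hb]
      exact ih l₁ (fun a ha hat => hl a ha (by simp [hat]))
  unfold edge
  rw [key y x h, key x y (fun a ha hax => h a hax ha)]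

/-! Three data decide a position: the lead in Generalized Sprigs, the sizes of the blossoms, and a
nim value. Sign the blossom values so that the moves of the player to move raise them, and let a
Sprig of signed value `v` contribute `sign v` at the index `|v|` of a finitely supported function
`c`. The degree of `c` is the opponent's lead in Sprigs. The lexicographic sign of `c`, read at the
smallest uncancelled index, carries the edge: among uncancelled Sprigs it is bad to own the smallest
blossom. A Sprig whose blossom has value 0 acts like `*` and belongs to the Nim part.

`MoverLoses` describes exactly the positions lost by the player to move. By `Move.cases`, a move
lowers the degree by one and lowers `c`, or keeps the degree and lowers `c`, or keeps the degree and
changes the nim value, or raises the degree. Hence no move from a losing position reaches one that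
is losing for the opponent. Conversely (`exists_winning_move`), the winner cuts an opposing Sprig,
plays Nim, or, when ahead, spends a tempo on his own Sprigs. The delicate case is `c = weight t -
weight u` with `0 < t < u` and nim value 0, where the simplicity of numbers provides the move
(`exists_option_le`).

Of Nim only two facts are needed: changing a heap changes the nim value, and smaller nim values can
be reached. Both survive in misère play if the nim value is changed by 1 when all heaps are at most
1, the second as long as some heap is nonempty. The finished game then has misère value 1, so a
player without a move is counted as a winner. One criterion thus serves both conventions, and the
misère nim value of the evil twin is the normal one of the original sum.

It remains to see that red-blue positions are numbers, that the graph games are played like abstract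
sums (a bisimulation), and that the sign of the edge gives the sign of `c`. -/

namespace Player

/-- The opponent. -/
def other : Player → Player
  | left => right
  | right => left

/-- `1` for Right and `-1` for Left, so that a move of the player raises the signed value. -/
def sign : Player → ℚ
  | left => -1
  | right => 1

@[simp] theorem sign_other (p : Player) : p.other.sign = -p.sign := by
  cases p <;> simp [other, sign]

end Player

/-! ### Simplest dyadic rationals -/

theorem isDyadic_of_mul_two_pow {x : ℚ} {k : ℤ} {n : ℕ} (h : x = k / 2 ^ n) : IsDyadic x := by
  have hd : x.den ∣ 2 ^ n := by
    have := Rat.den_dvd k (2 ^ n)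
    rw [h]
    have h2 : ((k : ℚ) / 2 ^ n) = Rat.divInt k (2 ^ n) := by
      rw [Rat.divInt_eq_div]; push_cast; rfl
    rw [h2]
    exact_mod_cast this
  obtain ⟨b, -, hb⟩ := (Nat.dvd_prime_pow Nat.prime_two).1 hd
  exact ⟨b, hb⟩

theorem exists_isDyadic_between {l r : ℚ} (h : l < r) : ∃ x, IsDyadic x ∧ l < x ∧ x < r := by
  obtain ⟨n, hn⟩ := exists_pow_lt_of_lt_one (sub_pos.2 h) (show (1 / 2 : ℚ) < 1 by norm_num)
  have hp : (0 : ℚ) < 2 ^ n := by positivity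
  refine ⟨((⌊l * 2 ^ n⌋ + 1 : ℤ) : ℚ) / 2 ^ n, isDyadic_of_mul_two_pow rfl, ?_, ?_⟩
  · rw [lt_div_iff₀ hp]
    push_cast
    exact Int.lt_floor_add_one _
  · rw [div_lt_iff₀ hp]
    have h1 := Int.floor_le (l * 2 ^ n)
    have h2 : 1 < (r - l) * 2 ^ n := by
      rw [one_div, inv_pow, inv_lt_iff_one_lt_mul₀ hp] at hn
      linarith
    push_cast
    linarith

theorem Set.Finite.exists_rat_between {A B : Set ℚ} (hA : A.Finite) (hB : B.Finite)
    (h : ∀ a ∈ A, ∀ b ∈ B, a < b) :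
    ∃ l r : ℚ, l < r ∧ (∀ a ∈ A, a ≤ l) ∧ ∀ b ∈ B, r ≤ b := by
  rcases A.eq_empty_or_nonempty with rfl | hAn
  · obtain ⟨r, hr⟩ := hB.bddBelow
    exact ⟨r - 1, r, by linarith, by simp, hr⟩
  · rcases B.eq_empty_or_nonempty with rfl | hBn
    · obtain ⟨l, hl⟩ := hA.bddAbove
      exact ⟨l, l + 1, by linarith, hl, by simp⟩
    · obtain ⟨l, hl, hl'⟩ := A.exists_max_image id hA hAn
      obtain ⟨r, hr, hr'⟩ := B.exists_min_image id hB hBn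
      exact ⟨l, r, h l hl r hr, hl', hr'⟩

theorem exists_isSimplestBetween {A B : Set ℚ} (hA : A.Finite) (hB : B.Finite)
    (h : ∀ a ∈ A, ∀ b ∈ B, a < b) : ∃ x, IsSimplestBetween A B x := by
  obtain ⟨l, r, hlr, hl, hr⟩ := hA.exists_rat_between hB h
  obtain ⟨x₀, hx₀, hlx, hxr⟩ := exists_isDyadic_between hlr
  let f : ℚ → ℕ ×ₗ ℕ := fun x => toLex (x.den, x.num.natAbs)
  obtain ⟨x, hx, hmin⟩ := (InvImage.wf f wellFounded_lt).has_min
    {x | IsDyadic x ∧ (∀ a ∈ A, a < x) ∧ ∀ b ∈ B, x < b}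
    ⟨x₀, hx₀, fun a ha => (hl a ha).trans_lt hlx, fun b hb => hxr.trans_le (hr b hb)⟩
  refine ⟨x, hx, fun y hy hyA hyB => ?_⟩
  have hle : f x ≤ f y := not_lt.1 (hmin y ⟨hy, hyA, hyB⟩)
  rw [Prod.Lex.toLex_le_toLex] at hle
  refine hle.imp id fun ⟨hd, hn⟩ => ⟨hd, ?_⟩
  dsimp only at hd hn
  -- With equal denominators, absolute values compare like absolute numerators, the second entry of
  -- `f`.
  rw [Rat.abs_def, Rat.abs_def, ← hd, Rat.divInt_eq_div, Rat.divInt_eq_div]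
  gcongr

namespace CGame

/-! ### Options and numbers -/

/-- `G'` is an option of `G` for the player. -/
def IsOption : Player → CGame → CGame → Prop
  | Player.left, mk _ _ L _, G' => ∃ i, G' = L i
  | Player.right, mk _ _ _ R, G' => ∃ j, G' = R j

theorem normalWinsFirst_iff (G : CGame) (p : Player) :
    G.NormalWinsFirst p ↔ ∃ G', IsOption p G G' ∧ ¬ G'.NormalWinsFirst p.other := by
  cases G; cases p <;> simp [NormalWinsFirst, IsOption, Player.other]

theorem misereWinsFirst_iff (G : CGame) (p : Player) :
    G.MisereWinsFirst p ↔ (¬ ∃ G', IsOption p G G') ∨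
      ∃ G', IsOption p G G' ∧ ¬ G'.MisereWinsFirst p.other := by
  cases G; cases p <;> simp [MisereWinsFirst, IsOption, Player.other, isEmpty_iff]

/-- The value of every follower is the simplest number between the values of its options. -/
def IsNumber : CGame → Prop
  | mk α β L R => (∀ i, (L i).IsNumber) ∧ (∀ j, (R j).IsNumber) ∧
      IsSimplestBetween (Set.range fun i => (L i).value) (Set.range fun j => (R j).value)
        (mk α β L R).value

theorem isNumber_mk {α β : Type} [Finite α] [Finite β] {L : α → CGame} {R : β → CGame}
    (hL : ∀ i, (L i).IsNumber) (hR : ∀ j, (R j).IsNumber)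
    (h : ∀ i j, (L i).value < (R j).value) : (mk α β L R).IsNumber := by
  have hex : ∃ x, IsSimplestBetween (Set.range fun i => (L i).value)
      (Set.range fun j => (R j).value) x :=
    exists_isSimplestBetween (Set.finite_range _) (Set.finite_range _) (by
      rintro _ ⟨i, rfl⟩ _ ⟨j, rfl⟩; exact h i j)
  refine ⟨hL, hR, ?_⟩
  rw [value, dif_pos hex]
  exact hex.choose_spec

/-- The value, with the sign that makes the moves of the player increase it. -/
noncomputable def signedValue (p : Player) (G : CGame) : ℚ := p.sign * G.value

theorem signedValue_other (p : Player) (G : CGame) :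
    G.signedValue p.other = -G.signedValue p := by simp [signedValue]

namespace IsNumber

variable {G G' : CGame} {p : Player}

theorem of_isOption (hG : G.IsNumber) (h : IsOption p G G') : G'.IsNumber := by
  cases G
  cases p <;> obtain ⟨i, rfl⟩ := h
  exacts [hG.1 i, hG.2.1 i]

theorem signedValue_lt (hG : G.IsNumber) (h : IsOption p G G') :
    G.signedValue p < G'.signedValue p := by
  cases G
  cases p <;> obtain ⟨i, rfl⟩ := h
  · simpa [signedValue, Player.sign] using hG.2.2.1.2.1 _ ⟨i, rfl⟩
  · simpa [signedValue, Player.sign] using hG.2.2.1.2.2 _ ⟨i, rfl⟩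

theorem isDyadic_signedValue (hG : G.IsNumber) (p : Player) : IsDyadic (G.signedValue p) := by
  have h : IsDyadic G.value := by cases G; exact hG.2.2.1.1
  cases p <;> simpa [signedValue, Player.sign, IsDyadic] using h

/-- The signed form of simplicity: a dyadic number in the gap between the value and the options of
one player also lies between all left and all right options, since the other player's options are on
the far side of the value. -/
theorem simplest (hG : G.IsNumber) {y : ℚ} (hy : IsDyadic y) (hlt : G.signedValue p < y)
    (hopt : ∀ G', IsOption p G G' → y < G'.signedValue p) :
    (G.signedValue p).den < y.den ∨
      ((G.signedValue p).den = y.den ∧ |G.signedValue p| ≤ |y|) := by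
  obtain ⟨α, β, L, R⟩ := G
  obtain ⟨-, -, ⟨-, h1, h2⟩, hs⟩ := hG
  cases p
  · have := hs (-y) (by simpa [IsDyadic] using hy)
      (by
        rintro _ ⟨i, rfl⟩
        have := hopt _ ⟨i, rfl⟩
        simp only [signedValue, Player.sign] at this
        dsimp only; linarith)
      (by
        rintro _ ⟨j, rfl⟩
        have := h2 _ ⟨j, rfl⟩
        simp only [signedValue, Player.sign] at hlt
        dsimp only at this ⊢; linarith)
    simpa [signedValue, Player.sign] using this
  · have := hs y hy
      (by
        rintro _ ⟨i, rfl⟩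
        have := h1 _ ⟨i, rfl⟩
        simp only [signedValue, Player.sign] at hlt
        dsimp only at this ⊢; linarith)
      (by
        rintro _ ⟨j, rfl⟩
        have := hopt _ ⟨j, rfl⟩
        simpa [signedValue, Player.sign] using this)
    simpa [signedValue, Player.sign] using this

/-- Zero is the simplest number of all; if it lay in the gap between a negative value and the
options, it would be the value. This move lets a player who is ahead spend a tempo on his own
blossom without handing it over. -/
theorem exists_option_nonpos (hG : G.IsNumber) (h : G.signedValue p < 0) :
    ∃ G', IsOption p G G' ∧ G'.signedValue p ≤ 0 := by
  by_contra! hcon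
  rcases hG.simplest (y := 0) ⟨0, by simp⟩ h hcon with h' | ⟨-, h'⟩
  · simp at h'
  · simp at h'
    exact h.ne h'

/-- If the player to move has `t > 0` and `-u` with `t < u`, he can move `t` to a number at most
`u` or `-u` to a number at most `-t`. -/
theorem exists_option_le {H : CGame} (hG : G.IsNumber) (hH : H.IsNumber)
    (hpos : 0 < G.signedValue p) (h : G.signedValue p < -H.signedValue p) :
    (∃ G', IsOption p G G' ∧ G'.signedValue p ≤ -H.signedValue p) ∨
      ∃ H', IsOption p H H' ∧ H'.signedValue p ≤ -G.signedValue p := by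
  by_contra! hcon
  have hd (K : CGame) (hK : K.IsNumber) : IsDyadic (-K.signedValue p) := by
    simpa [IsDyadic] using hK.isDyadic_signedValue p
  -- Each number now lies in the gap of the other, so each is at least as simple as the other. The
  -- denominators agree, and the comparison of absolute values contradicts `t < u`.
  have h1 := hG.simplest (hd H hH) h hcon.1
  have h2 := hH.simplest (p := p) (hd G hG) (by linarith) hcon.2
  simp only [Rat.den_neg_eq_den, abs_neg] at h1 h2
  have h3 : |G.signedValue p| < |H.signedValue p| := by
    rw [abs_of_pos hpos, abs_of_neg (by linarith)]
    exact h
  rcases h1 with h1 | h1 <;> rcases h2 with h2 | h2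
  · omega
  · omega
  · omega
  · linarith [h1.2, h2.2]

end IsNumber

end CGame

namespace EdgeColor

/-- The edges that a player may cut. -/
def CutBy (c : EdgeColor) : Player → Prop
  | Player.left => c ≠ red
  | Player.right => c ≠ blue

end EdgeColor

namespace Hackenbush

/-! ### Pruning -/

variable {H : Hackenbush} {S T : Set H.E}

theorem Grounded.mono (h : S ⊆ T) {v : H.V} (hv : H.Grounded S v) : H.Grounded T v := by
  induction hv with
  | base hv => exact .base hv
  | step he huv _ ih => exact .step (h he) huv ih

theorem prune_mono (h : S ⊆ T) : H.prune S ⊆ H.prune T :=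
  fun _ he => ⟨h he.1, he.2.imp fun _ hv => ⟨hv.1, hv.2.mono h⟩⟩

theorem prune_subset (S : Set H.E) : H.prune S ⊆ S := fun _ he => he.1

theorem Grounded.prune {v : H.V} (hv : H.Grounded S v) : H.Grounded (H.prune S) v := by
  induction hv with
  | base hv => exact .base hv
  | @step u v e he huv hu ih => exact .step ⟨he, u, by simp [huv], hu⟩ huv ih

theorem prune_prune (S : Set H.E) : H.prune (H.prune S) = H.prune S :=
  (prune_subset _).antisymm fun _ he => ⟨he, he.2.imp fun _ hv => ⟨hv.1, hv.2.prune⟩⟩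

/-- Pruning between two cuts makes no difference, so two successive cuts commute. -/
theorem prune_prune_diff (S : Set H.E) (e : H.E) :
    H.prune (H.prune S \ {e}) = H.prune (S \ {e}) := by
  refine (prune_mono (Set.sdiff_subset_sdiff_left (prune_subset S))).antisymm ?_
  rw [← prune_prune (S \ {e})]
  exact prune_mono fun f hf => ⟨prune_mono Set.sdiff_subset hf, hf.1.2⟩

/-- A path from the ground either avoids `e` or reaches an end of `e` before first using it. -/
theorem Grounded.diff_or {v : H.V} (hv : H.Grounded S v) (e : H.E) :
    H.Grounded (S \ {e}) v ∨ ∃ w ∈ H.ends e, H.Grounded (S \ {e}) w := by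
  induction hv with
  | base hv => exact .inl (.base hv)
  | @step u v f hf huv _ ih =>
    refine ih.elim (fun hu => ?_) .inr
    by_cases hfe : f = e
    · exact .inr ⟨u, by simp [← hfe, huv], hu⟩
    · exact .inl (.step ⟨hf, hfe⟩ huv hu)

/-- If cutting `e` makes `f` fall, then `e` does not fall when `f` is cut. -/
theorem mem_prune_diff_of_notMem {e f : H.E} (he : e ∈ H.prune S) (hf : f ∈ S) (hne : e ≠ f)
    (h : f ∉ H.prune (S \ {e})) : e ∈ H.prune (S \ {f}) := by
  obtain ⟨heS, v, hv, hg⟩ := he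
  obtain ⟨w, hw, hg⟩ : ∃ w ∈ H.ends e, H.Grounded (S \ {e}) w :=
    (hg.diff_or e).elim (fun hg => ⟨v, hv, hg⟩) id
  rcases hg.diff_or f with hg | ⟨u, hu, hg⟩
  · exact ⟨⟨heS, hne⟩, w, hw, hg.mono (Set.sdiff_subset_sdiff_left Set.sdiff_subset)⟩
  · exact absurd ⟨⟨hf, hne.symm⟩, u, hu, hg.mono Set.sdiff_subset⟩ h

theorem prune_diff_diff_of_notMem {e f : H.E} (h : f ∉ H.prune (S \ {e})) :
    H.prune (H.prune (S \ {f}) \ {e}) = H.prune (S \ {e}) := by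
  rw [prune_prune_diff, Set.sdiff_sdiff_comm, ← prune_prune_diff (S \ {e}), Set.sdiff_singleton_eq_self h,
    prune_prune]

/-! ### The options of a Hackenbush position -/

theorem isOption_gameOn {p : Player} {G' : CGame} :
    CGame.IsOption p (H.gameOn S) G' ↔
      ∃ e ∈ S, (H.color e).CutBy p ∧ G' = H.gameOn (H.prune (S \ {e})) := by
  rw [gameOn]
  cases p <;> simp [CGame.IsOption, EdgeColor.CutBy, and_assoc]

/-! ### Red-blue Hackenbush positions are numbers -/

/-- For a blue edge `e` and a red edge `f` that survive each other's cut, cutting both in either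
order gives `G^L < G^{LR} = G^{RL} < G^R`. If one of them falls with the other, it is still there to
be cut first, and one of the two inequalities already links `G^L` and `G^R`. -/
theorem IsRedBlue.isNumber_gameOn (hH : H.IsRedBlue) (hS : H.prune S = S) :
    (H.gameOn S).IsNumber := by
  have := H.finite_E
  induction hn : S.ncard using Nat.strong_induction_on generalizing S with
  | _ n ih =>
  subst hn
  have hnum {e : H.E} (he : e ∈ S) : (H.gameOn (H.prune (S \ {e}))).IsNumber :=
    ih _ (H.ncard_prune_lt S he) (prune_prune _) rfl
  have hlt {p : Player} {T : Set H.E} {e : H.E} (hT : (H.gameOn T).IsNumber) (he : e ∈ T)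
      (hp : (H.color e).CutBy p) :
      (H.gameOn T).signedValue p < (H.gameOn (H.prune (T \ {e}))).signedValue p :=
    hT.signedValue_lt (isOption_gameOn.2 ⟨e, he, hp, rfl⟩)
  rw [gameOn]
  refine CGame.isNumber_mk (fun e => hnum e.2.1) (fun f => hnum f.2.1) ?_
  rintro ⟨e, he, hec⟩ ⟨f, hf, hfc⟩
  have hef : e ≠ f := by
    rintro rfl
    cases hc : H.color e <;> simp_all [IsRedBlue]
  dsimp only
  have hL {T : Set H.E} (hT : (H.gameOn T).IsNumber) (he : e ∈ T) :
      (H.gameOn (H.prune (T \ {e}))).value < (H.gameOn T).value := by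
    simpa [CGame.signedValue, Player.sign] using hlt (p := Player.left) hT he hec
  have hR {T : Set H.E} (hT : (H.gameOn T).IsNumber) (hf : f ∈ T) :
      (H.gameOn T).value < (H.gameOn (H.prune (T \ {f}))).value := by
    simpa [CGame.signedValue, Player.sign] using hlt (p := Player.right) hT hf hfc
  have heS : e ∈ H.prune S := hS.symm ▸ he
  have hfS : f ∈ H.prune S := hS.symm ▸ hf
  by_cases h1 : f ∈ H.prune (S \ {e})
  · by_cases h2 : e ∈ H.prune (S \ {f})
    · have h3 := hR (hnum he) h1
      have h4 := hL (hnum hf) h2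
      rw [prune_prune_diff, Set.sdiff_sdiff_comm] at h3
      rw [prune_prune_diff] at h4
      exact h3.trans h4
    · have h3 := hR (hnum he) h1
      rwa [prune_diff_diff_of_notMem h2] at h3
  · have h4 := hL (hnum hf) (mem_prune_diff_of_notMem heS hf hef h1)
    rwa [prune_diff_diff_of_notMem h1] at h4

theorem IsRedBlue.isNumber_toGame (hH : H.IsRedBlue) : H.toGame.IsNumber :=
  hH.isNumber_gameOn (prune_prune _)

end Hackenbush

/-! ### Nim -/

/-- The two play conventions. -/
inductive Convention : Type where
  | normal
  | misere

/-- The nim-sum of a multiset of heap sizes. -/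
def xorSum (s : Multiset ℕ) : ℕ := s.fold (· ^^^ ·) 0

@[simp] theorem xorSum_zero : xorSum 0 = 0 := rfl

@[simp] theorem xorSum_cons (h : ℕ) (s : Multiset ℕ) : xorSum (h ::ₘ s) = h ^^^ xorSum s :=
  Multiset.fold_cons_left ..

theorem xorSum_lt_two {s : Multiset ℕ} (hs : ∀ h ∈ s, h < 2) : xorSum s < 2 := by
  induction s using Multiset.induction with
  | empty => simp
  | cons h s ih =>
    rw [xorSum_cons]
    simp only [Multiset.mem_cons, forall_eq_or_imp] at hs
    exact Nat.xor_lt_two_pow (n := 1) hs.1 (ih hs.2)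

theorem exists_xorSum_cons_eq {s : Multiset ℕ} {b : ℕ} (hb : b < xorSum s) :
    ∃ h t k, s = h ::ₘ t ∧ k < h ∧ xorSum (k ::ₘ t) = b := by
  induction s using Multiset.induction generalizing b with
  | empty => simp at hb
  | cons h s ih =>
    rw [xorSum_cons] at hb
    rcases Nat.lt_xor_cases hb with hlt | hlt
    · exact ⟨h, s, _, rfl, hlt, by simp⟩
    · obtain ⟨h', t, k, rfl, hk, hsum⟩ := ih hlt
      refine ⟨h', h ::ₘ t, k, Multiset.cons_swap .., hk, ?_⟩
      rw [Multiset.cons_swap, xorSum_cons, hsum, Nat.xor_comm b, ← Nat.xor_assoc]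
      simp

namespace Convention

open scoped Classical in
/-- The nim value that decides a sum: the nim-sum of the heaps, except that in misère play it is
changed by `1` if all heaps have size at most `1`. -/
noncomputable def nim : Convention → Multiset ℕ → ℕ
  | normal, s => xorSum s
  | misere, s => if ∃ h ∈ s, 2 ≤ h then xorSum s else xorSum s ^^^ 1

theorem nim_misere_of_exists {s : Multiset ℕ} (hs : ∃ h ∈ s, 2 ≤ h) : misere.nim s = xorSum s :=
  if_pos hs

theorem nim_misere_of_forall {s : Multiset ℕ} (hs : ∀ h ∈ s, h < 2) :
    misere.nim s = xorSum s ^^^ 1 :=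
  if_neg (by push Not; exact hs)

theorem nim_cons_ne_of_lt (m : Convention) {h k : ℕ} (s : Multiset ℕ) (hk : k < h) :
    m.nim (h ::ₘ s) ≠ m.nim (k ::ₘ s) := by
  have hne : xorSum (h ::ₘ s) ≠ xorSum (k ::ₘ s) := by simpa using hk.ne'
  cases m
  · exact hne
  · by_cases hs : ∃ x ∈ s, 2 ≤ x
    · obtain ⟨x, hx, hx2⟩ := hs
      rwa [nim_misere_of_exists ⟨x, by simp [hx], hx2⟩, nim_misere_of_exists ⟨x, by simp [hx], hx2⟩]
    · push Not at hs
      by_cases hk2 : 2 ≤ k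
      · rwa [nim_misere_of_exists ⟨h, by simp, by omega⟩, nim_misere_of_exists ⟨k, by simp, hk2⟩]
      rw [nim_misere_of_forall (s := k ::ₘ s) (Multiset.forall_mem_cons.2 ⟨by omega, hs⟩)]
      by_cases hh : 2 ≤ h
      · rw [nim_misere_of_exists ⟨h, by simp, hh⟩]
        simp only [xorSum_cons]
        intro heq
        -- Only here does the correction by 1 apply to one side alone; equality would then force the
        -- large heap `h` to be less than 2.
        have h1 : h = k ^^^ 1 := by
          have := congrArg (· ^^^ xorSum s) heq
          simp only [Nat.xor_assoc, Nat.xor_self, Nat.xor_zero] at this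
          rw [this, Nat.xor_comm 1, ← Nat.xor_assoc (xorSum s)]
          simp
        have : k ^^^ 1 < 2 := Nat.xor_lt_two_pow (n := 1) (by omega) (by omega)
        omega
      · rw [nim_misere_of_forall (s := h ::ₘ s) (Multiset.forall_mem_cons.2 ⟨by omega, hs⟩)]
        simpa using hk.ne'

theorem nim_cons_ne (m : Convention) {h k : ℕ} (s : Multiset ℕ) (hk : h ≠ k) :
    m.nim (h ::ₘ s) ≠ m.nim (k ::ₘ s) :=
  hk.lt_or_gt.elim (fun hk => (m.nim_cons_ne_of_lt s hk).symm) (m.nim_cons_ne_of_lt s)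

/-- Describes a Sprig whose blossom is moved to value 0: it enters the Nim part as a new heap of
size 1. -/
theorem nim_one_cons (m : Convention) (s : Multiset ℕ) :
    m.nim (1 ::ₘ s) = m.nim (0 ::ₘ s) ^^^ 1 := by
  have hx : xorSum (1 ::ₘ s) = xorSum (0 ::ₘ s) ^^^ 1 := by simp [Nat.xor_comm]
  cases m
  · exact hx
  · by_cases hs : ∃ x ∈ s, 2 ≤ x
    · obtain ⟨x, hx', hx2⟩ := hs
      rw [nim_misere_of_exists ⟨x, by simp [hx'], hx2⟩, nim_misere_of_exists ⟨x, by simp [hx'], hx2⟩,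
        hx]
    · push Not at hs
      rw [nim_misere_of_forall (Multiset.forall_mem_cons.2 ⟨by omega, hs⟩),
        nim_misere_of_forall (Multiset.forall_mem_cons.2 ⟨by omega, hs⟩), hx]

theorem nim_of_forall_eq_zero {s : Multiset ℕ} (hs : ∀ h ∈ s, h = 0) :
    normal.nim s = 0 ∧ misere.nim s = 1 := by
  have h0 : xorSum s = 0 := by
    induction s using Multiset.induction with
    | empty => rfl
    | cons h s ih =>
      rw [Multiset.forall_mem_cons] at hs
      simp [hs.1, ih hs.2]
  refine ⟨h0, ?_⟩
  rw [nim_misere_of_forall fun h hh => by simp [hs h hh], h0, Nat.zero_xor]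

/-- In Nim, every smaller value can be reached, unless the game is over. -/
theorem exists_nim_cons_eq (m : Convention) {s : Multiset ℕ} {b : ℕ} (hb : b < m.nim s)
    (hs : ∃ h ∈ s, h ≠ 0) :
    ∃ h t k, s = h ::ₘ t ∧ k < h ∧ m.nim (k ::ₘ t) = b := by
  cases m
  · exact exists_xorSum_cons_eq hb
  · by_cases hs2 : ∃ h ∈ s, 2 ≤ h
    · rw [nim_misere_of_exists hs2] at hb
      obtain ⟨h, t, k, rfl, hk, hsum⟩ := exists_xorSum_cons_eq hb
      by_cases ht : ∃ x ∈ k ::ₘ t, 2 ≤ x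
      · exact ⟨h, t, k, rfl, hk, by rw [nim_misere_of_exists ht, hsum]⟩
      · push Not at ht
        have hk2 : k < 2 := ht k (by simp)
        have hk1 : k ^^^ 1 < 2 := Nat.xor_lt_two_pow (n := 1) hk2 (by omega)
        have ht' : ∀ x ∈ t, x < 2 := fun x hx => ht x (by simp [hx])
        have hh : 2 ≤ h := by
          obtain ⟨x, hx, hx2⟩ := hs2
          rcases Multiset.mem_cons.1 hx with rfl | hx
          · exact hx2
          · have := ht' x hx
            omega
        -- The normal-play move leaves only heaps below 2, where the correction applies; moving to
        -- `k ^^^ 1` undoes it. The move is legal because `h` was the heap of size at least 2.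
        refine ⟨h, t, k ^^^ 1, rfl, by omega, ?_⟩
        rw [nim_misere_of_forall (Multiset.forall_mem_cons.2 ⟨hk1, ht'⟩), ← hsum, xorSum_cons, xorSum_cons,
          Nat.xor_assoc, Nat.xor_comm (xorSum t), Nat.xor_assoc k, ← Nat.xor_assoc 1]
        simp
    · push Not at hs2
      obtain ⟨h, hh, h0⟩ := hs
      obtain ⟨t, rfl⟩ := Multiset.exists_cons_of_mem hh
      obtain rfl : h = 1 := by
        have := hs2 h hh
        omega
      refine ⟨1, t, 0, rfl, one_pos, ?_⟩
      have hlt : misere.nim (1 ::ₘ t) < 2 := by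
        rw [nim_misere_of_forall hs2]
        exact Nat.xor_lt_two_pow (n := 1) (xorSum_lt_two hs2) (by omega)
      have h1 : misere.nim (1 ::ₘ t) = 1 := by omega
      have h2 := nim_one_cons misere t
      have h3 : misere.nim (0 ::ₘ t) = 0 := by
        have := congrArg (· ^^^ 1) (h2.symm.trans h1)
        simpa [Nat.xor_assoc] using this
      omega

end Convention

/-! ### Lexicographically ordered advantages -/

namespace Advantage

open Finsupp

/-- The contribution of a Generalized Sprig `*:(v)`: the sign of `v`, placed at `|v|`. -/
noncomputable def weight (v : ℚ) : Lex (ℚ →₀ ℤ) := toLex (single |v| (SignType.sign v : ℤ))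

/-- The sum of all coefficients. -/
noncomputable def deg : Lex (ℚ →₀ ℤ) →+ ℤ where
  toFun c := degree (ofLex c)
  map_zero' := degree.map_zero
  map_add' a b := degree.map_add (ofLex a) (ofLex b)

theorem deg_weight (v : ℚ) : deg (weight v) = SignType.sign v := degree_single _ _

@[simp] theorem weight_zero : weight 0 = 0 := by simp [weight]

theorem weight_neg (v : ℚ) : weight (-v) = -weight v := by
  simp [weight, Left.sign_neg]

theorem weight_of_pos {v : ℚ} (hv : 0 < v) : weight v = toLex (single v 1) := by
  simp [weight, sign_pos hv, abs_of_pos hv]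

theorem deg_weight_of_pos {v : ℚ} (hv : 0 < v) : deg (weight v) = 1 := by
  simp [deg_weight, sign_pos hv]

theorem deg_weight_of_neg {v : ℚ} (hv : v < 0) : deg (weight v) = -1 := by
  simp [deg_weight, sign_neg hv]

theorem weight_pos {v : ℚ} (hv : 0 < v) : 0 < weight v := by
  rw [weight_of_pos hv, Lex.lt_iff]
  exact ⟨v, fun j hj => by simp [hj.ne'], by simp⟩

/-- The lexicographic order looks at the smallest index first, so a smaller blossom weighs more than
a larger one. -/
theorem weight_lt_of_pos {v w : ℚ} (hv : 0 < v) (h : v < w) : weight w < weight v := by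
  rw [weight_of_pos hv, weight_of_pos (hv.trans h), Lex.lt_iff]
  exact ⟨v, fun j hj => by simp [hj.ne', (hj.trans h).ne'], by simp [h.ne']⟩

theorem weight_le_of_pos {v w : ℚ} (hv : 0 < v) (h : v ≤ w) : weight w ≤ weight v :=
  h.eq_or_lt.elim (fun h => h ▸ le_rfl) fun h => (weight_lt_of_pos hv h).le

theorem weight_lt_of_neg {v w : ℚ} (hw : w < 0) (h : v < w) : weight w < weight v := by
  have := weight_lt_of_pos (neg_pos.2 hw) (neg_lt_neg h)
  rwa [weight_neg, weight_neg, neg_lt_neg_iff] at this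

theorem eq_zero_of_nonpos {c : Lex (ℚ →₀ ℤ)} (h : ∀ u, ofLex c u ≤ 0) (hc : deg c = 0) :
    c = 0 := by
  have h0 : ∑ i ∈ (ofLex c).support, ofLex c i = 0 := hc
  rw [Finset.sum_eq_zero_iff_of_nonpos fun i _ => h i] at h0
  refine ofLex.injective (Finsupp.ext fun u => ?_)
  by_cases hu : u ∈ (ofLex c).support
  · exact h0 u hu
  · exact notMem_support_iff.1 hu

theorem exists_neg_of_deg_neg {c : Lex (ℚ →₀ ℤ)} (hc : deg c < 0) : ∃ u, ofLex c u < 0 := by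
  have h0 : ∑ i ∈ (ofLex c).support, ofLex c i < 0 := hc
  by_contra! hcon
  exact h0.not_ge (Finset.sum_nonneg fun i _ => hcon i)

/-- If `0 < c < weight t` and no coefficient of `c` beyond `t` is positive, then `c` has a single
positive coefficient, `1` at `t`. -/
theorem coeff_of_lt_weight {c : Lex (ℚ →₀ ℤ)} {t : ℚ} (ht : 0 < t) (h0 : 0 < c)
    (hlt : c < weight t) (hmax : ∀ u, t < u → ofLex c u ≤ 0) :
    ofLex c t = 1 ∧ ∀ u, u ≠ t → ofLex c u ≤ 0 := by
  rw [weight_of_pos ht, Lex.lt_iff] at hlt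
  rw [Lex.lt_iff] at h0
  obtain ⟨i, hi, hci⟩ := h0
  obtain ⟨k, hk, hck⟩ := hlt
  simp only [ofLex_zero, coe_zero, Pi.zero_apply, ofLex_toLex] at hi hci hk hck
  have hit : i ≤ t := not_lt.1 fun h => (hmax i h).not_gt hci
  -- Here `i` is the first nonzero coefficient of `c` and `k` its first difference from `weight t`.
  -- Once `i < k` is known, the coefficient at `i` is that of `weight t`, which forces `i = t`.
  have hik : i < k := by
    by_contra! hki
    have hkt : k ≤ t := hki.trans hit
    rcases hkt.eq_or_lt with rfl | hkt
    · obtain rfl : i = k := le_antisymm hit hki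
      simp at hck
      omega
    · rw [single_eq_of_ne hkt.ne] at hck
      rcases hki.eq_or_lt with rfl | hki
      · omega
      · have := hi k hki
        omega
  have h1 := hk i hik
  obtain rfl : i = t := by
    by_contra hne
    rw [single_eq_of_ne hne] at h1
    omega
  refine ⟨by simpa using h1, fun u hu => ?_⟩
  rcases hu.lt_or_gt with hu | hu
  · exact (hi u hu).ge
  · exact hmax u hu

end Advantage

/-! ### Sums of Generalized Sprigs and Stalks, abstractly -/

/-- A component of a sum: a Generalized Sprig whose blossom is a number, or a Stalk. A component that
has been removed is a Stalk of height `0`. -/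
inductive Component : Type 1 where
  | sprig (B : {B : CGame // B.IsNumber}) : Component
  | stalk (h : ℕ) : Component

namespace Component

/-- The value of the blossom, signed so that the moves of the player increase it. -/
noncomputable def signedValue (p : Player) : Component → ℚ
  | sprig B => B.1.signedValue p
  | stalk _ => 0

open scoped Classical in
/-- The size of the Nim heap to which the component is equivalent; Generalized Sprigs with blossoms
of nonzero value do not count. -/
noncomputable def heap : Component → ℕ
  | sprig B => if B.1.value = 0 then 1 else 0
  | stalk h => h

/-- The moves of the player. -/
inductive Move (p : Player) : Component → Component → Prop where
  | cut (B : {B : CGame // B.IsNumber}) : Move p (sprig B) (stalk 0)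
  | blossom {B B' : {B : CGame // B.IsNumber}} (h : CGame.IsOption p B.1 B'.1) :
      Move p (sprig B) (sprig B')
  | stalk {h k : ℕ} (hk : k < h) : Move p (stalk h) (stalk k)

theorem heap_sprig_of_ne {B : {B : CGame // B.IsNumber}} {p : Player}
    (h : B.1.signedValue p ≠ 0) : (sprig B).heap = 0 :=
  if_neg fun h0 => h (by simp [CGame.signedValue, h0])

theorem heap_sprig_of_eq {B : {B : CGame // B.IsNumber}} {p : Player}
    (h : B.1.signedValue p = 0) : (sprig B).heap = 1 := by
  refine if_pos ?_
  cases p <;> simpa [CGame.signedValue, Player.sign] using h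

end Component

namespace SumPosition

open Advantage Component

/-- The moves of the player in a sum. -/
def Move (p : Player) (X X' : Multiset Component) : Prop :=
  ∃ c c' X₀, X = c ::ₘ X₀ ∧ X' = c' ::ₘ X₀ ∧ Component.Move p c c'

/-- The advantage of the player, refined by the values of the blossoms. -/
noncomputable def total (p : Player) (X : Multiset Component) : Lex (ℚ →₀ ℤ) :=
  (X.map fun c => weight (c.signedValue p)).sum

/-- The Nim heaps of a sum. -/
noncomputable def heaps (X : Multiset Component) : Multiset ℕ := X.map heap

/-- The condition under which the player to move loses, where `c` is his total and `a` the nim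
value. -/
def MoverLoses (c : Lex (ℚ →₀ ℤ)) (a : ℕ) : Prop :=
  2 ≤ deg c ∨ (deg c = 1 ∧ (a ≠ 0 ∨ c < 0)) ∨ (deg c = 0 ∧ a = 0 ∧ c ≤ 0)

variable {p : Player} {m : Convention} {X X' : Multiset Component}

@[simp] theorem total_cons (p : Player) (c : Component) (X : Multiset Component) :
    total p (c ::ₘ X) = weight (c.signedValue p) + total p X := by simp [total]

@[simp] theorem heaps_cons (c : Component) (X : Multiset Component) :
    heaps (c ::ₘ X) = c.heap ::ₘ heaps X := by simp [heaps]

theorem total_other (p : Player) (X : Multiset Component) : total p.other X = -total p X := by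
  rw [total, total, ← Multiset.sum_map_neg', Multiset.map_map]
  refine congrArg Multiset.sum (Multiset.map_congr rfl fun c _ => ?_)
  rw [Function.comp_apply, ← weight_neg]
  cases c <;> simp [signedValue, CGame.signedValue_other]

/-- Coefficients record only what survives cancellation, but a positive one must come from an actual
Sprig. -/
theorem exists_sprig_of_coeff_pos {u : ℚ} (h : 0 < ofLex (total p X) u) :
    0 < u ∧ ∃ B, sprig B ∈ X ∧ B.1.signedValue p = u := by
  induction X using Multiset.induction with
  | empty => simp [total] at h
  | cons c X ih =>
    by_cases hX : 0 < ofLex (total p X) u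
    · obtain ⟨hu, B, hB, hBu⟩ := ih hX
      exact ⟨hu, B, by simp [hB], hBu⟩
    · rw [total_cons] at h
      have hw : 0 < ofLex (weight (c.signedValue p)) u := by
        simp only [ofLex_add, Finsupp.add_apply] at h
        omega
      simp only [weight, ofLex_toLex, Finsupp.single_apply] at hw
      split_ifs at hw with hcu
      · have hpos : 0 < c.signedValue p := by
          rcases lt_trichotomy (c.signedValue p) 0 with h | h | h
          · simp [sign_neg h] at hw
          · simp [h] at hw
          · exact h
        rw [abs_of_pos hpos] at hcu
        subst hcu
        refine ⟨hpos, ?_⟩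
        cases c with
        | sprig B => exact ⟨B, by simp, rfl⟩
        | stalk h => simp [signedValue] at hpos
      · simp at hw

theorem exists_sprig_of_coeff_neg {u : ℚ} (h : ofLex (total p X) u < 0) :
    0 < u ∧ ∃ B, sprig B ∈ X ∧ B.1.signedValue p = -u := by
  obtain ⟨hu, B, hB, hBu⟩ := exists_sprig_of_coeff_pos (p := p.other) (X := X) (u := u) (by
    rw [total_other]
    simpa using h)
  refine ⟨hu, B, hB, ?_⟩
  rw [CGame.signedValue_other] at hBu
  linarith

theorem exists_sprig_of_deg_neg (h : deg (total p X) < 0) :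
    ∃ B, sprig B ∈ X ∧ B.1.signedValue p < 0 := by
  obtain ⟨u, hu⟩ := exists_neg_of_deg_neg h
  obtain ⟨hu, B, hB, hBu⟩ := exists_sprig_of_coeff_neg hu
  exact ⟨B, hB, by linarith⟩

theorem exists_sprig_of_deg_pos (h : 0 < deg (total p X)) :
    ∃ B, sprig B ∈ X ∧ 0 < B.1.signedValue p := by
  obtain ⟨B, hB, hB0⟩ := exists_sprig_of_deg_neg (p := p.other) (X := X) (by
    rw [total_other, map_neg]
    omega)
  rw [CGame.signedValue_other] at hB0
  exact ⟨B, hB, by linarith⟩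

/-! #### The effect of a move -/

/-- The four alternatives are: cutting an opposing Sprig; a blossom move that keeps the sign of the
value, which enlarges an opposing blossom or shrinks one of the player's own; a Nim move, including
cutting a Sprig of blossom value 0; and a move that gives up an own Sprig or turns a zero blossom
into an opposing one. -/
theorem Move.cases (m : Convention) (h : Move p X X') :
    (deg (total p X') = deg (total p X) - 1 ∧ total p X' < total p X ∧
      m.nim (heaps X') = m.nim (heaps X)) ∨
    (deg (total p X') = deg (total p X) ∧ total p X' < total p X ∧
      m.nim (heaps X') = m.nim (heaps X)) ∨
    (deg (total p X') = deg (total p X) ∧ m.nim (heaps X') ≠ m.nim (heaps X)) ∨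
    deg (total p X) < deg (total p X') := by
  obtain ⟨c, c', X₀, rfl, rfl, hc⟩ := h
  simp only [total_cons, heaps_cons, map_add]
  cases hc with
  | cut B =>
    simp only [signedValue, weight_zero, map_zero, zero_add]
    rcases lt_trichotomy (B.1.signedValue p) 0 with hB | hB | hB
    · rw [deg_weight_of_neg hB]
      exact .inr (.inr (.inr (by omega)))
    · rw [hB, heap_sprig_of_eq hB]
      exact .inr (.inr (.inl ⟨by simp, m.nim_cons_ne _ zero_ne_one⟩))
    · rw [deg_weight_of_pos hB, heap_sprig_of_ne hB.ne']
      exact .inl ⟨by omega, lt_add_of_pos_left _ (weight_pos hB), rfl⟩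
  | @blossom B B' hBB =>
    have hlt := B.2.signedValue_lt hBB
    simp only [signedValue]
    rcases lt_trichotomy (B.1.signedValue p) 0 with hB | hB | hB
    · rcases lt_or_ge (B'.1.signedValue p) 0 with hB' | hB'
      · rw [deg_weight_of_neg hB, deg_weight_of_neg hB', heap_sprig_of_ne hB.ne,
          heap_sprig_of_ne hB'.ne]
        exact .inr (.inl ⟨rfl, by simpa using weight_lt_of_neg hB' hlt, rfl⟩)
      · refine .inr (.inr (.inr ?_))
        rw [deg_weight_of_neg hB]
        rcases hB'.eq_or_lt with hB' | hB'
        · rw [← hB']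
          simp
        · rw [deg_weight_of_pos hB']
          omega
    · rw [hB] at hlt
      rw [hB, deg_weight_of_pos hlt]
      exact .inr (.inr (.inr (by simp)))
    · have hB' := hB.trans hlt
      rw [deg_weight_of_pos hB, deg_weight_of_pos hB', heap_sprig_of_ne hB.ne',
        heap_sprig_of_ne hB'.ne']
      exact .inr (.inl ⟨rfl, by simpa using weight_lt_of_pos hB hlt, rfl⟩)
  | stalk hk => exact .inr (.inr (.inl ⟨rfl, m.nim_cons_ne _ hk.ne⟩))

/-- Losing for the mover requires degree at least 0 before the move, and losing for the opponent
requires degree at most 0 after it. As a move lowers the degree by at most one, only the changes 1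
to 0, 0 to -1 and 0 to 0 are possible; there the fall of the total or the change of the nim value
contradicts the two losing conditions. -/
theorem MoverLoses.not_moverLoses_of_move (hX : MoverLoses (total p X) (m.nim (heaps X)))
    (h : Move p X X') : ¬ MoverLoses (-total p X') (m.nim (heaps X')) := by
  intro hX'
  simp only [MoverLoses, map_neg, neg_lt_zero, neg_nonpos] at hX hX'
  rcases h.cases m with ⟨hd, hlt, hm⟩ | ⟨hd, hlt, hm⟩ | ⟨hd, hm⟩ | hd
  · rw [hm, hd] at hX'
    rcases hX with h1 | ⟨h1, h2⟩ | ⟨h1, h2, h3⟩ <;>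
      rcases hX' with h4 | ⟨h4, h5⟩ | ⟨h4, h5, h6⟩ <;> try omega
    · exact (h2.resolve_left (not_not.2 h5)).not_ge (h6.trans hlt.le)
    · exact ((h5.resolve_left (not_not.2 h2)).trans hlt).not_ge h3
  · rw [hm, hd] at hX'
    rcases hX with h1 | ⟨h1, h2⟩ | ⟨h1, h2, h3⟩ <;>
      rcases hX' with h4 | ⟨h4, h5⟩ | ⟨h4, h5, h6⟩ <;> try omega
    exact (h6.trans_lt hlt).not_ge h3
  · rcases hX with h1 | ⟨h1, h2⟩ | ⟨h1, h2, h3⟩ <;>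
      rcases hX' with h4 | ⟨h4, h5⟩ | ⟨h4, h5, h6⟩ <;> omega
  · rcases hX with h1 | ⟨h1, h2⟩ | ⟨h1, h2, h3⟩ <;>
      rcases hX' with h4 | ⟨h4, h5⟩ | ⟨h4, h5, h6⟩ <;> omega

/-! #### Available moves -/

variable {B B' : {B : CGame // B.IsNumber}}

theorem exists_move_cut (m : Convention) (hB : sprig B ∈ X) (h : B.1.signedValue p ≠ 0) :
    ∃ X', Move p X X' ∧ total p X' = total p X - weight (B.1.signedValue p) ∧
      m.nim (heaps X') = m.nim (heaps X) := by
  obtain ⟨X₀, rfl⟩ := Multiset.exists_cons_of_mem hB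
  refine ⟨stalk 0 ::ₘ X₀, ⟨_, _, _, rfl, rfl, .cut B⟩, ?_, ?_⟩
  · simp [signedValue]
  · rw [heaps_cons, heaps_cons, heap_sprig_of_ne h]
    rfl

theorem exists_move_blossom (m : Convention) (hB : sprig B ∈ X) (h : B.1.signedValue p ≠ 0)
    (hBB : CGame.IsOption p B.1 B'.1) :
    ∃ X', Move p X X' ∧
      total p X' = total p X - weight (B.1.signedValue p) + weight (B'.1.signedValue p) ∧
      (B'.1.signedValue p ≠ 0 → m.nim (heaps X') = m.nim (heaps X)) ∧
      (B'.1.signedValue p = 0 → m.nim (heaps X') = m.nim (heaps X) ^^^ 1) := by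
  obtain ⟨X₀, rfl⟩ := Multiset.exists_cons_of_mem hB
  refine ⟨sprig B' ::ₘ X₀, ⟨_, _, _, rfl, rfl, .blossom hBB⟩, ?_, fun h' => ?_, fun h' => ?_⟩
  · simp [signedValue, add_comm]
  · rw [heaps_cons, heaps_cons, heap_sprig_of_ne h, heap_sprig_of_ne h']
  · rw [heaps_cons, heaps_cons, heap_sprig_of_ne h, heap_sprig_of_eq h', m.nim_one_cons]

theorem exists_move_nim {b : ℕ} (hb : b < m.nim (heaps X)) (hX : ∃ c ∈ X, c.heap ≠ 0) :
    ∃ X', Move p X X' ∧ total p X' = total p X ∧ m.nim (heaps X') = b := by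
  obtain ⟨h, t, k, hs, hk, hb⟩ := m.exists_nim_cons_eq hb (by simpa [heaps] using hX)
  classical
  obtain ⟨c, hc, rfl, rfl⟩ := (Multiset.map_eq_cons ..).2 hs
  obtain ⟨X₀, rfl⟩ := Multiset.exists_cons_of_mem hc
  rw [Multiset.erase_cons_head] at hb
  have hc0 : c.signedValue p = 0 ∧ Component.Move p c (stalk k) := by
    cases c with
    | stalk h => exact ⟨rfl, .stalk hk⟩
    -- A Sprig that counts as a nonempty heap has blossom value 0, and its only Nim move is to cut
    -- the stem.
    | sprig B =>
      have h0 : B.1.signedValue p = 0 := by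
        by_contra h0
        rw [heap_sprig_of_ne h0] at hk
        omega
      rw [heap_sprig_of_eq h0, Nat.lt_one_iff] at hk
      exact ⟨h0, hk ▸ .cut B⟩
  refine ⟨stalk k ::ₘ X₀, ⟨c, _, _, rfl, rfl, hc0.2⟩, ?_, ?_⟩
  · rw [total_cons, total_cons, hc0.1]
    rfl
  · rw [heaps_cons]
    exact hb

end SumPosition

namespace SumPosition

open Advantage Component

variable {p : Player} {m : Convention} {X X' : Multiset Component}

/-! #### Winning moves -/

theorem coeff_nonpos_of_forall {u : ℚ}
    (h : ∀ B, sprig B ∈ X → B.1.signedValue p ≠ u) : ofLex (total p X) u ≤ 0 := by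
  by_contra! hu
  obtain ⟨-, B, hB, hBu⟩ := exists_sprig_of_coeff_pos hu
  exact h B hB hBu

theorem coeff_nonpos (h : ∀ B, sprig B ∈ X → B.1.signedValue p ≤ 0) (u : ℚ) :
    ofLex (total p X) u ≤ 0 := by
  by_contra! hu
  obtain ⟨hu0, B, hB, rfl⟩ := exists_sprig_of_coeff_pos hu
  exact hu0.not_ge (h B hB)

/-- A negative coefficient cancels if the coefficients are nonpositive with sum `-1`. -/
theorem eq_neg_weight {c : Lex (ℚ →₀ ℤ)} {u : ℚ} (h : ∀ v, ofLex c v ≤ 0) (hc : deg c = -1)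
    (hu : 0 < u) (hcu : ofLex c u < 0) : c = -weight u := by
  rw [← add_eq_zero_iff_eq_neg]
  refine eq_zero_of_nonpos (fun v => ?_) (by rw [map_add, hc, deg_weight_of_pos hu]; rfl)
  have h1 := h v
  rw [weight_of_pos hu]
  by_cases hv : v = u
  · subst hv
    simp
    omega
  · simp [Finsupp.single_eq_of_ne hv, h1]

theorem total_eq_weight (h : ∀ B, sprig B ∈ X → B.1.signedValue p ≤ 0)
    (hd : deg (total p X) = -1) {B : {B : CGame // B.IsNumber}} (hB : sprig B ∈ X)
    (hneg : B.1.signedValue p < 0) : total p X = weight (B.1.signedValue p) := by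
  obtain ⟨X₀, rfl⟩ := Multiset.exists_cons_of_mem hB
  rw [total_cons, map_add, signedValue, deg_weight_of_neg hneg] at hd
  rw [total_cons, eq_zero_of_nonpos (c := total p X₀)
    (coeff_nonpos fun B' hB' => h B' (by simp [hB'])) (by omega), add_zero]
  rfl

theorem exists_max_sprig (h : ∃ B, sprig B ∈ X ∧ 0 < B.1.signedValue p) :
    ∃ B, sprig B ∈ X ∧ 0 < B.1.signedValue p ∧
      ∀ B', sprig B' ∈ X → B'.1.signedValue p ≤ B.1.signedValue p := by
  obtain ⟨B₀, hB₀, hpos⟩ := h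
  obtain ⟨c, hc, hmax⟩ := Multiset.exists_max_image (fun c : Component => c.signedValue p)
    (s := X) (by rintro rfl; simp at hB₀)
  have h0 := hmax _ hB₀
  cases c with
  | stalk h => exact absurd h0 hpos.not_ge
  | sprig B => exact ⟨B, hc, hpos.trans_le h0, fun B' hB' => hmax _ hB'⟩

/-- Cut the opposing Sprig with the largest blossom, the one of least weight. If the rest were
negative, `coeff_of_lt_weight` would leave it no positive coefficient, and degree 0 would make it
zero. -/
theorem exists_winning_move_of_deg_eq_one (h : deg (total p X) = 1) (ha : m.nim (heaps X) = 0)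
    (h0 : 0 ≤ total p X) :
    ∃ X', Move p X X' ∧ MoverLoses (-total p X') (m.nim (heaps X')) := by
  obtain ⟨B, hB, hpos, hmax⟩ := exists_max_sprig (exists_sprig_of_deg_pos (h ▸ one_pos))
  obtain ⟨X', hX', htot, hnim⟩ := exists_move_cut m hB hpos.ne'
  refine ⟨X', hX', .inr (.inr ⟨?_, hnim.trans ha, ?_⟩)⟩
  · rw [htot, map_neg, map_sub, h, deg_weight_of_pos hpos]
    rfl
  rw [htot, neg_nonpos, sub_nonneg]
  by_contra! hlt
  have hne : total p X ≠ 0 := fun h0 => by simp [h0] at h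
  obtain ⟨h1, h2⟩ := coeff_of_lt_weight hpos (h0.lt_of_ne hne.symm) hlt fun u hu =>
    coeff_nonpos_of_forall fun B' hB' => ((hmax B' hB').trans_lt hu).ne
  refine hlt.ne (sub_eq_zero.1 (eq_zero_of_nonpos (fun u => ?_) ?_))
  · rw [weight_of_pos hpos]
    by_cases hu : u = B.1.signedValue p
    · subst hu
      simp [h1]
    · simp [Finsupp.single_eq_of_ne hu, h2 u hu]
  · rw [map_sub, h, deg_weight_of_pos hpos, sub_self]

/-- If the total is at least the weight of the largest opposing blossom `t`, cutting that Sprig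
wins. Otherwise everything cancels except one opposing `t` against one own `u`, with `t < u`, and a
blossom move that does not overshoot leaves a nonnegative total. -/
theorem exists_winning_move_of_deg_eq_zero (h : deg (total p X) = 0) (ha : m.nim (heaps X) = 0)
    (h0 : 0 < total p X) :
    ∃ X', Move p X X' ∧ MoverLoses (-total p X') (m.nim (heaps X')) := by
  have hex : ∃ B, sprig B ∈ X ∧ 0 < B.1.signedValue p := by
    by_contra! hcon
    exact h0.ne' (eq_zero_of_nonpos (coeff_nonpos hcon) h)
  obtain ⟨B, hB, hpos, hmax⟩ := exists_max_sprig hex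
  by_cases hlt : total p X < weight (B.1.signedValue p)
  · obtain ⟨h1, h2⟩ := coeff_of_lt_weight hpos h0 hlt fun u hu =>
      coeff_nonpos_of_forall fun B' hB' => ((hmax B' hB').trans_lt hu).ne
    set t := B.1.signedValue p with ht
    have hr : ∀ u, ofLex (total p X - weight t) u ≤ 0 := fun u => by
      rw [weight_of_pos hpos]
      by_cases hu : u = t
      · subst hu
        simp [h1]
      · simp [Finsupp.single_eq_of_ne hu, h2 u hu]
    have hrd : deg (total p X - weight t) = -1 := by
      rw [map_sub, h, deg_weight_of_pos hpos]
      rfl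
    obtain ⟨u, hu⟩ := exists_neg_of_deg_neg (hrd ▸ neg_one_lt_zero)
    have hcu : ofLex (total p X) u < 0 := by
      rw [weight_of_pos hpos] at hu
      by_cases hut : u = t
      · subst hut
        simp [h1] at hu
      · simpa [Finsupp.single_eq_of_ne hut] using hu
    obtain ⟨hu0, C, hC, hCu⟩ := exists_sprig_of_coeff_neg hcu
    have heq : total p X = weight t - weight u := by
      rw [sub_eq_iff_eq_add.1 (eq_neg_weight hr hrd hu0 hu), neg_add_eq_sub]
    have htu : t < u := by
      by_contra! hut
      rw [heq, sub_pos] at h0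
      exact h0.not_ge (weight_le_of_pos hu0 hut)
    obtain rfl : u = -C.1.signedValue p := by linarith
    rcases B.2.exists_option_le C.2 hpos htu with ⟨G', hG', hle⟩ | ⟨G', hG', hle⟩
    · have hGpos := hpos.trans (B.2.signedValue_lt hG')
      obtain ⟨X', hX', htot, hnim, -⟩ := exists_move_blossom (B' := ⟨G', B.2.of_isOption hG'⟩)
        m hB hpos.ne' hG'
      refine ⟨X', hX', .inr (.inr ⟨?_, (hnim hGpos.ne').trans ha, ?_⟩)⟩
      · rw [htot, map_neg, map_add, map_sub, h, deg_weight_of_pos hpos, deg_weight_of_pos hGpos]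
        rfl
      · rw [htot, heq, neg_nonpos]
        have := weight_le_of_pos hGpos hle
        rw [← ht, sub_right_comm, sub_self, zero_sub, neg_add_eq_sub, sub_nonneg]
        exact this
    · have hCneg : C.1.signedValue p < 0 := by linarith
      have hGneg : CGame.signedValue p G' < 0 := by linarith
      obtain ⟨X', hX', htot, hnim, -⟩ := exists_move_blossom (B' := ⟨G', C.2.of_isOption hG'⟩)
        m hC hCneg.ne hG'
      refine ⟨X', hX', .inr (.inr ⟨?_, (hnim hGneg.ne).trans ha, ?_⟩)⟩
      · rw [htot, map_neg, map_add, map_sub, h, deg_weight_of_neg hCneg, deg_weight_of_neg hGneg]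
        rfl
      · rw [htot, heq, neg_nonpos, weight_neg, sub_neg_eq_add, add_sub_cancel_right]
        have := weight_le_of_pos hpos (le_neg_of_le_neg hle)
        rw [weight_neg] at this
        exact neg_le_iff_add_nonneg.1 this
  · obtain ⟨X', hX', htot, hnim⟩ := exists_move_cut m hB hpos.ne'
    have hd : deg (total p X') = -1 := by
      rw [htot, map_sub, h, deg_weight_of_pos hpos]
      rfl
    refine ⟨X', hX', .inr (.inl ⟨by simp [hd], .inr ?_⟩)⟩
    rw [neg_lt_zero]
    refine lt_of_le_of_ne ?_ fun h0 => by simp [← h0] at hd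
    rw [htot, sub_nonneg]
    exact not_lt.1 hlt

/-- The hypothesis `hm` excludes the finished misère game, which the player to move wins without a
move. -/
theorem exists_winning_move (hX : ¬ MoverLoses (total p X) (m.nim (heaps X)))
    (hm : m = .misere → ∃ X', Move p X X') :
    ∃ X', Move p X X' ∧ MoverLoses (-total p X') (m.nim (heaps X')) := by
  have hlt : ¬ 2 ≤ deg (total p X) := fun h => hX (.inl h)
  rcases lt_or_ge 0 (deg (total p X)) with h0 | h0
  · have h1 : deg (total p X) = 1 := by omega
    have h2 : ¬ (m.nim (heaps X) ≠ 0 ∨ total p X < 0) := fun h => hX (.inr (.inl ⟨h1, h⟩))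
    push Not at h2
    exact exists_winning_move_of_deg_eq_one h1 h2.1 h2.2
  by_cases hpos : ∃ B, sprig B ∈ X ∧ 0 < B.1.signedValue p
  · by_cases hz : deg (total p X) = 0 ∧ m.nim (heaps X) = 0
    · refine exists_winning_move_of_deg_eq_zero hz.1 hz.2 ?_
      by_contra! hle
      exact hX (.inr (.inr ⟨hz.1, hz.2, hle⟩))
    -- The degree is at most 0; cutting any opposing Sprig leaves the opponent facing a lead of at
    -- least 2, or of 1 with nonzero nim value.
    · obtain ⟨B, hB, hpos⟩ := hpos
      obtain ⟨X', hX', htot, hnim⟩ := exists_move_cut m hB hpos.ne'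
      refine ⟨X', hX', ?_⟩
      simp only [MoverLoses, htot, hnim, map_neg, map_sub, deg_weight_of_pos hpos]
      rcases h0.eq_or_lt with h0 | h0
      · exact .inr (.inl ⟨by omega, .inl fun ha => hz ⟨h0, ha⟩⟩)
      · exact .inl (by omega)
  · push Not at hpos
    have hcoeff := coeff_nonpos hpos
    rcases h0.eq_or_lt with h0 | h0
    · have ht : total p X = 0 := eq_zero_of_nonpos hcoeff h0
      have ha : m.nim (heaps X) ≠ 0 := fun ha => hX (.inr (.inr ⟨h0, ha, ht.le⟩))
      -- All Sprigs left have blossom value 0, so if every heap were empty there would be no move at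
      -- all. This is where `hm` is used.
      have hnonneg : ∀ B, sprig B ∈ X → 0 ≤ B.1.signedValue p := by
        intro B hB
        by_contra! hneg
        obtain ⟨X₀, rfl⟩ := Multiset.exists_cons_of_mem hB
        have hd := h0
        rw [total_cons, map_add, signedValue, deg_weight_of_neg hneg] at hd
        obtain ⟨B', hB', hpos'⟩ := exists_sprig_of_deg_pos (p := p) (X := X₀) (by omega)
        exact hpos'.not_ge (hpos B' (by simp [hB']))
      have hheap : ∃ c ∈ X, c.heap ≠ 0 := by
        by_contra! hcon
        have hz := Convention.nim_of_forall_eq_zero (s := heaps X) (by simpa [heaps] using hcon)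
        cases m with
        | normal => exact ha hz.1
        | misere =>
          obtain ⟨_, c, c', X₀, rfl, -, hc⟩ := hm rfl
          have hc0 := hcon c (by simp)
          cases c with
          | sprig B =>
            rw [heap_sprig_of_eq (le_antisymm (hpos B (by simp)) (hnonneg B (by simp)))] at hc0
            exact one_ne_zero hc0
          | stalk h =>
            cases hc with
            | stalk hk => exact (Nat.zero_le _).not_gt (hk.trans_eq hc0)
      obtain ⟨X', hX', htot, hnim⟩ := exists_move_nim (p := p) (Nat.pos_of_ne_zero ha) hheap
      exact ⟨X', hX', .inr (.inr ⟨by simp [htot, h0], hnim, by simp [htot, ht]⟩)⟩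
    · obtain ⟨B, hB, hneg⟩ := exists_sprig_of_deg_neg h0
      -- From here on all Sprigs of nonzero value are the mover's own, and he must spend a tempo. In
      -- these cases he can afford to cut one of them.
      by_cases hcut : deg (total p X) ≤ -3 ∨ (deg (total p X) = -2 ∧ m.nim (heaps X) ≠ 0) ∨
          (deg (total p X) = -1 ∧ m.nim (heaps X) = 0)
      · obtain ⟨X', hX', htot, hnim⟩ := exists_move_cut m hB hneg.ne
        refine ⟨X', hX', ?_⟩
        have hd : deg (-total p X') = -deg (total p X) - 1 := by
          rw [htot, map_neg, map_sub, deg_weight_of_neg hneg]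
          omega
        rw [MoverLoses, hd, hnim]
        rcases hcut with h | ⟨h, ha⟩ | ⟨h, ha⟩
        · exact .inl (by omega)
        · exact .inr (.inl ⟨by omega, .inl ha⟩)
        · refine .inr (.inr ⟨by omega, ha, ?_⟩)
          rw [htot, total_eq_weight hpos h hB hneg, sub_self, neg_zero]
      -- Keep the lead of 1 and leave the nonzero nim value 1.
      by_cases hbig : deg (total p X) = -1 ∧ 2 ≤ m.nim (heaps X)
      · have hheap : ∃ c ∈ X, c.heap ≠ 0 := by
          by_contra! hcon
          have hz := Convention.nim_of_forall_eq_zero (s := heaps X) (by simpa [heaps] using hcon)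
          cases m <;> omega
        obtain ⟨X', hX', htot, hnim⟩ := exists_move_nim (p := p) (b := 1) hbig.2 hheap
        exact ⟨X', hX', .inr (.inl ⟨by simp [htot, hbig.1], .inl (by simp [hnim])⟩)⟩
      -- What remains is a lead of 2 with nim value 0, or a lead of 1 with nim value 1. A blossom
      -- moved to 0 costs one Sprig but changes the nim value by 1; a blossom that stays negative
      -- costs nothing.
      · obtain ⟨G', hG', hle⟩ := B.2.exists_option_nonpos hneg
        obtain ⟨X', hX', htot, hnim, hnim'⟩ :=
          exists_move_blossom (B' := ⟨G', B.2.of_isOption hG'⟩) m hB hneg.ne hG'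
        refine ⟨X', hX', ?_⟩
        rcases hle.eq_or_lt with hle | hle
        · rw [hle, weight_zero, add_zero] at htot
          have hnim := hnim' hle
          have hd : deg (-total p X') = -deg (total p X) - 1 := by
            rw [htot, map_neg, map_sub, deg_weight_of_neg hneg]
            omega
          rw [MoverLoses, hd, hnim]
          by_cases h2 : deg (total p X) = -2
          · have ha : m.nim (heaps X) = 0 := by omega
            exact .inr (.inl ⟨by omega, .inl (by simp [ha])⟩)
          · have ha : m.nim (heaps X) = 1 := by omega
            refine .inr (.inr ⟨by omega, by simp [ha], ?_⟩)
            rw [htot, total_eq_weight hpos (by omega) hB hneg, sub_self, neg_zero]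
        · have hd : deg (-total p X') = -deg (total p X) := by
            rw [htot, map_neg, map_add, map_sub, deg_weight_of_neg hneg, deg_weight_of_neg hle]
            omega
          rw [MoverLoses, hd, hnim hle.ne]
          by_cases h2 : deg (total p X) = -2
          · exact .inl (by omega)
          · exact .inr (.inl ⟨by omega, .inl (by omega)⟩)

/-- In misère play a player who has no move wins. -/
theorem MoverLoses.exists_move (hX : MoverLoses (total p X) (Convention.misere.nim (heaps X))) :
    ∃ X', Move p X X' := by
  by_contra! hcon
  have hc : ∀ c ∈ X, c = stalk 0 := by
    intro c hc
    obtain ⟨X₀, rfl⟩ := Multiset.exists_cons_of_mem hc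
    cases c with
    | sprig B => exact absurd ⟨_, _, _, rfl, rfl, .cut B⟩ (hcon (stalk 0 ::ₘ X₀))
    | stalk h =>
      by_contra h0
      have hpos : 0 < h := Nat.pos_of_ne_zero fun hh => h0 (by rw [hh])
      exact hcon (stalk 0 ::ₘ X₀) ⟨_, _, _, rfl, rfl, .stalk hpos⟩
  have hn := (Convention.nim_of_forall_eq_zero (s := heaps X) (by
    intro h hh
    obtain ⟨c, hcX, rfl⟩ := Multiset.mem_map.1 hh
    rw [hc c hcX]
    rfl)).2
  have ht : total p X = 0 := by
    rw [total, Multiset.map_congr rfl (g := fun _ => 0) fun c hcX => by simp [hc c hcX, signedValue]]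
    simp
  rw [hn, ht] at hX
  simp [MoverLoses] at hX

end SumPosition

/-! ### Bisimulations between games and sums of components -/

namespace CGame

theorem option_induction {motive : CGame → Prop}
    (h : ∀ G, (∀ p G', IsOption p G G' → motive G') → motive G) (G : CGame) : motive G := by
  induction G with
  | mk α β L R ihL ihR =>
    refine h _ fun p G' hG' => ?_
    cases p <;> obtain ⟨i, rfl⟩ := hG'
    exacts [ihL i, ihR i]

end CGame

namespace SumPosition

open Component Convention

/-- A bisimulation between games and sums of components. -/
structure IsBisimulation (R : CGame → Multiset Component → Prop) : Prop where
  forth {p : Player} {G G' : CGame} {X : Multiset Component} (h : R G X)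
    (hG : CGame.IsOption p G G') : ∃ X', Move p X X' ∧ R G' X'
  back {p : Player} {G : CGame} {X X' : Multiset Component} (h : R G X) (hX : Move p X X') :
    ∃ G', CGame.IsOption p G G' ∧ R G' X'

/-- The game is played like the sum of components. -/
def Realizes (G : CGame) (X : Multiset Component) : Prop := ∃ R, IsBisimulation R ∧ R G X

/-- The union of all bisimulations is a bisimulation, so the outcome proofs need not carry a
particular one. -/
theorem isBisimulation_realizes : IsBisimulation Realizes where
  forth := fun ⟨R, hR, h⟩ hG =>
    (hR.forth h hG).imp fun _ hX' => ⟨hX'.1, R, hR, hX'.2⟩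
  back := fun ⟨R, hR, h⟩ hX =>
    (hR.back h hX).imp fun _ hG' => ⟨hG'.1, R, hR, hG'.2⟩

variable {G : CGame} {X : Multiset Component}

theorem Realizes.normalWinsFirst_iff (h : Realizes G X) (p : Player) :
    G.NormalWinsFirst p ↔ ¬ MoverLoses (total p X) (normal.nim (heaps X)) := by
  induction G using CGame.option_induction generalizing X p with
  | h G ih =>
  rw [CGame.normalWinsFirst_iff]
  constructor
  · rintro ⟨G', hG', hlose⟩ hX
    obtain ⟨X', hX', h'⟩ := isBisimulation_realizes.forth h hG'
    rw [ih p G' hG' h', not_not, total_other] at hlose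
    exact hX.not_moverLoses_of_move hX' hlose
  · intro hX
    obtain ⟨X', hX', hlose⟩ := exists_winning_move hX (by simp)
    obtain ⟨G', hG', h'⟩ := isBisimulation_realizes.back h hX'
    refine ⟨G', hG', ?_⟩
    rwa [ih p G' hG' h', not_not, total_other]

/-- As in normal play, with one more case: a player without a move wins, and
`MoverLoses.exists_move` shows that such a position is not counted as lost. -/
theorem Realizes.misereWinsFirst_iff (h : Realizes G X) (p : Player) :
    G.MisereWinsFirst p ↔ ¬ MoverLoses (total p X) (misere.nim (heaps X)) := by
  induction G using CGame.option_induction generalizing X p with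
  | h G ih =>
  rw [CGame.misereWinsFirst_iff]
  constructor
  · rintro (hG | ⟨G', hG', hlose⟩) hX
    · obtain ⟨X', hX'⟩ := hX.exists_move
      obtain ⟨G', hG', -⟩ := isBisimulation_realizes.back h hX'
      exact hG ⟨G', hG'⟩
    · obtain ⟨X', hX', h'⟩ := isBisimulation_realizes.forth h hG'
      rw [ih p G' hG' h', not_not, total_other] at hlose
      exact hX.not_moverLoses_of_move hX' hlose
  · intro hX
    by_cases hG : ∃ G', CGame.IsOption p G G'
    · obtain ⟨X', hX', hlose⟩ := exists_winning_move hX fun _ =>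
        hG.elim fun G' hG' => (isBisimulation_realizes.forth h hG').imp fun _ hX' => hX'.1
      obtain ⟨G', hG', h'⟩ := isBisimulation_realizes.back h hX'
      refine .inr ⟨G', hG', ?_⟩
      rwa [ih p G' hG' h', not_not, total_other]
    · exact .inl hG

theorem move_singleton_iff {p : Player} {c : Component} {X : Multiset Component} :
    Move p {c} X ↔ ∃ c', X = {c'} ∧ c.Move p c' := by
  constructor
  · rintro ⟨c₁, c', X₀, h, rfl, hc⟩
    obtain ⟨rfl, rfl⟩ := Multiset.singleton_eq_cons_iff X₀ |>.1 h
    exact ⟨c', rfl, hc⟩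
  · rintro ⟨c', rfl, hc⟩
    exact ⟨c, c', 0, rfl, rfl, hc⟩

theorem move_add_iff {p : Player} {X Y Z : Multiset Component} :
    Move p (X + Y) Z ↔
      (∃ X', Move p X X' ∧ Z = X' + Y) ∨ ∃ Y', Move p Y Y' ∧ Z = X + Y' := by
  constructor
  · rintro ⟨c, c', Z₀, h, rfl, hc⟩
    have hmem : c ∈ X + Y := by simp [h]
    rcases Multiset.mem_add.1 hmem with hcX | hcY
    · obtain ⟨X₀, rfl⟩ := Multiset.exists_cons_of_mem hcX
      rw [Multiset.cons_add, Multiset.cons_inj_right] at h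
      exact .inl ⟨c' ::ₘ X₀, ⟨c, c', X₀, rfl, rfl, hc⟩, by rw [← h, Multiset.cons_add]⟩
    · obtain ⟨Y₀, rfl⟩ := Multiset.exists_cons_of_mem hcY
      rw [Multiset.add_cons, Multiset.cons_inj_right] at h
      exact .inr ⟨c' ::ₘ Y₀, ⟨c, c', Y₀, rfl, rfl, hc⟩, by rw [← h, Multiset.add_cons]⟩
  · rintro (⟨_, ⟨c, c', X₀, rfl, rfl, hc⟩, rfl⟩ | ⟨_, ⟨c, c', Y₀, rfl, rfl, hc⟩, rfl⟩)
    · exact ⟨c, c', X₀ + Y, by simp, by simp, hc⟩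
    · exact ⟨c, c', X + Y₀, by simp, by simp, hc⟩

end SumPosition

namespace Hackenbush

open SumPosition Component

theorem Grounded.of_mem {H : Hackenbush} {S : Set H.E} {e : H.E} {u v : H.V}
    (hu : H.Grounded S u) (he : e ∈ S) (hue : u ∈ H.ends e) (hve : v ∈ H.ends e) :
    H.Grounded S v := by
  by_cases huv : u = v
  · exact huv ▸ hu
  · exact .step he ((Sym2.mem_and_mem_iff huv).1 ⟨hue, hve⟩) hu

/-! ### Sums -/

/-- The edges of a sum that belong to given sets of edges of the summands. -/
def addSet {G H : Hackenbush} (S : Set G.E) (T : Set H.E) : Set (G.add H).E :=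
  {e | Sum.elim (· ∈ S) (· ∈ T) e}

section add

variable {G H : Hackenbush} {S : Set G.E} {T : Set H.E}

theorem grounded_addSet {w : (G.add H).V} :
    (G.add H).Grounded (addSet S T) w ↔ Sum.elim (G.Grounded S) (H.Grounded T) w := by
  constructor
  · intro h
    induction h with
    | base hv =>
      rcases hv with ⟨v, hv, rfl⟩ | ⟨v, hv, rfl⟩
      exacts [Grounded.base hv, Grounded.base hv]
    | @step u v e he huv _ ih =>
      have hue : u ∈ (G.add H).ends e := by simp [huv]
      have hve : v ∈ (G.add H).ends e := by simp [huv]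
      rcases e with e | e
      · obtain ⟨u, hu, rfl⟩ := Sym2.mem_map.1 hue
        obtain ⟨v, hv, rfl⟩ := Sym2.mem_map.1 hve
        exact Grounded.of_mem (H := G) ih he hu hv
      · obtain ⟨u, hu, rfl⟩ := Sym2.mem_map.1 hue
        obtain ⟨v, hv, rfl⟩ := Sym2.mem_map.1 hve
        exact Grounded.of_mem (H := H) ih he hu hv
  · rcases w with w | w <;> intro h
    · change G.Grounded S w at h
      induction h with
      | base hv => exact .base (.inl ⟨_, hv, rfl⟩)
      | @step u v e he huv _ ih =>
        refine .step (e := Sum.inl e) he ?_ ih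
        change (G.ends e).map Sum.inl = _
        rw [huv]
        rfl
    · change H.Grounded T w at h
      induction h with
      | base hv => exact .base (.inr ⟨_, hv, rfl⟩)
      | @step u v e he huv _ ih =>
        refine .step (e := Sum.inr e) he ?_ ih
        change (H.ends e).map Sum.inr = _
        rw [huv]
        rfl

theorem prune_addSet : (G.add H).prune (addSet S T) = addSet (G.prune S) (H.prune T) := by
  ext e
  rcases e with e | e
  · refine and_congr Iff.rfl ⟨?_, ?_⟩
    · rintro ⟨w, hw, hg⟩
      obtain ⟨v, hv, rfl⟩ := Sym2.mem_map.1 hw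
      exact ⟨v, hv, grounded_addSet.1 hg⟩
    · rintro ⟨v, hv, hg⟩
      exact ⟨Sum.inl v, Sym2.mem_map.2 ⟨v, hv, rfl⟩, grounded_addSet.2 hg⟩
  · refine and_congr Iff.rfl ⟨?_, ?_⟩
    · rintro ⟨w, hw, hg⟩
      obtain ⟨v, hv, rfl⟩ := Sym2.mem_map.1 hw
      exact ⟨v, hv, grounded_addSet.1 hg⟩
    · rintro ⟨v, hv, hg⟩
      exact ⟨Sum.inr v, Sym2.mem_map.2 ⟨v, hv, rfl⟩, grounded_addSet.2 hg⟩

theorem prune_addSet_diff_inl (hT : H.prune T = T) (e : G.E) :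
    (G.add H).prune (addSet S T \ {Sum.inl e}) = addSet (G.prune (S \ {e})) T := by
  have h : (addSet S T \ {Sum.inl e} : Set (G.add H).E) = addSet (S \ {e}) T := by
    ext f
    rcases f with f | f
    · exact and_congr Iff.rfl (not_congr Sum.inl_injective.eq_iff)
    · exact and_iff_left Sum.inr_ne_inl
  rw [h, prune_addSet, hT]

theorem prune_addSet_diff_inr (hS : G.prune S = S) (e : H.E) :
    (G.add H).prune (addSet S T \ {Sum.inr e}) = addSet S (H.prune (T \ {e})) := by
  have h : (addSet S T \ {Sum.inr e} : Set (G.add H).E) = addSet S (T \ {e}) := by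
    ext f
    rcases f with f | f
    · exact and_iff_left Sum.inl_ne_inr
    · exact and_congr Iff.rfl (not_congr Sum.inr_injective.eq_iff)
  rw [h, prune_addSet, hS]

theorem isOption_gameOn_addSet (hS : G.prune S = S) (hT : H.prune T = T) {p : Player}
    {K : CGame} : CGame.IsOption p ((G.add H).gameOn (addSet S T)) K ↔
      (∃ e ∈ S, (G.color e).CutBy p ∧ K = (G.add H).gameOn (addSet (G.prune (S \ {e})) T)) ∨
      ∃ e ∈ T, (H.color e).CutBy p ∧ K = (G.add H).gameOn (addSet S (H.prune (T \ {e}))) := by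
  rw [isOption_gameOn]
  constructor
  · rintro ⟨e | e, he, hc, rfl⟩
    · exact .inl ⟨e, he, hc, congrArg _ (prune_addSet_diff_inl hT e)⟩
    · exact .inr ⟨e, he, hc, congrArg _ (prune_addSet_diff_inr hS e)⟩
  · rintro (⟨e, he, hc, rfl⟩ | ⟨e, he, hc, rfl⟩)
    · exact ⟨Sum.inl e, he, hc, congrArg _ (prune_addSet_diff_inl hT e).symm⟩
    · exact ⟨Sum.inr e, he, hc, congrArg _ (prune_addSet_diff_inr hS e).symm⟩

theorem realizes_add {X Y : Multiset Component} (hG : Realizes G.toGame X)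
    (hH : Realizes H.toGame Y) : Realizes (G.add H).toGame (X + Y) := by
  -- The edge sets are kept pruned, so that a cut in one summand leaves the other unchanged.
  refine ⟨fun K Z => ∃ S T X Y, G.prune S = S ∧ H.prune T = T ∧
    K = (G.add H).gameOn (addSet S T) ∧ Realizes (G.gameOn S) X ∧ Realizes (H.gameOn T) Y ∧
    Z = X + Y, ⟨?_, ?_⟩, ?_⟩
  · rintro p _ K' _ ⟨S, T, X, Y, hS, hT, rfl, hX, hY, rfl⟩ hK
    rcases (isOption_gameOn_addSet hS hT).1 hK with ⟨e, he, hc, rfl⟩ | ⟨e, he, hc, rfl⟩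
    · obtain ⟨X', hX', hr⟩ := isBisimulation_realizes.forth hX
        (isOption_gameOn.2 ⟨e, he, hc, rfl⟩)
      exact ⟨_, move_add_iff.2 (.inl ⟨X', hX', rfl⟩), _, T, X', Y, prune_prune _, hT, rfl, hr, hY,
        rfl⟩
    · obtain ⟨Y', hY', hr⟩ := isBisimulation_realizes.forth hY
        (isOption_gameOn.2 ⟨e, he, hc, rfl⟩)
      exact ⟨_, move_add_iff.2 (.inr ⟨Y', hY', rfl⟩), S, _, X, Y', hS, prune_prune _, rfl, hX, hr,
        rfl⟩
  · rintro p _ _ Z ⟨S, T, X, Y, hS, hT, rfl, hX, hY, rfl⟩ hZ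
    rcases move_add_iff.1 hZ with ⟨X', hX', rfl⟩ | ⟨Y', hY', rfl⟩
    · obtain ⟨G', hG', hr⟩ := isBisimulation_realizes.back hX hX'
      obtain ⟨e, he, hc, rfl⟩ := isOption_gameOn.1 hG'
      exact ⟨_, (isOption_gameOn_addSet hS hT).2 (.inl ⟨e, he, hc, rfl⟩), _, T, X', Y,
        prune_prune _, hT, rfl, hr, hY, rfl⟩
    · obtain ⟨G', hG', hr⟩ := isBisimulation_realizes.back hY hY'
      obtain ⟨e, he, hc, rfl⟩ := isOption_gameOn.1 hG'
      exact ⟨_, (isOption_gameOn_addSet hS hT).2 (.inr ⟨e, he, hc, rfl⟩), S, _, X, Y',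
        hS, prune_prune _, rfl, hX, hr, rfl⟩
  · refine ⟨_, _, X, Y, prune_prune Set.univ, prune_prune Set.univ, ?_, hG, hH, rfl⟩
    rw [toGame, ← prune_addSet]
    congr 2
    ext e
    rcases e with e | e <;> simp [addSet]

end add

theorem realizes_empty : Realizes empty.toGame 0 := by
  refine ⟨fun K Z => K = empty.toGame ∧ Z = 0, ⟨?_, ?_⟩, rfl, rfl⟩
  · rintro p _ K' _ ⟨rfl, rfl⟩ hK
    obtain ⟨e, -⟩ := isOption_gameOn.1 hK
    exact e.elim
  · rintro p _ _ Z ⟨rfl, rfl⟩ ⟨c, c', X₀, h, -⟩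
    exact absurd h.symm (Multiset.cons_ne_zero)

/-! ### Stalks -/

/-- The lowest `k` edges of a Stalk. -/
def stalkSet (h k : ℕ) : Set (stalk h).E := {i | Fin.val (n := h) i < k}

theorem val_of_mem_ends_stalk {h : ℕ} {e : (stalk h).E} {v : (stalk h).V}
    (hv : v ∈ (stalk h).ends e) :
    Fin.val (n := h) e ≤ Fin.val (n := h + 1) v ∧
      Fin.val (n := h + 1) v ≤ Fin.val (n := h) e + 1 := by
  rcases Sym2.mem_iff.1 hv with rfl | rfl
  exacts [⟨le_rfl, Nat.le_succ _⟩, ⟨Nat.le_succ _, le_rfl⟩]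

/-- With edge `k` missing, no path climbs above vertex `k`. -/
theorem Grounded.le_of_stalk {h k : ℕ} {S : Set (stalk h).E}
    (hS : ∀ e ∈ S, Fin.val (n := h) e ≠ k) {v : (stalk h).V} (hv : (stalk h).Grounded S v) :
    Fin.val (n := h + 1) v ≤ k := by
  induction hv with
  | base hv =>
    rw [Set.mem_singleton_iff.1 hv]
    exact Nat.zero_le _
  | @step u v e he huv _ ih =>
    have hue : u ∈ (stalk h).ends e := huv ▸ Sym2.mem_mk_left ..
    have hve : v ∈ (stalk h).ends e := huv ▸ Sym2.mem_mk_right ..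
    have hek := hS e he
    have hu := (val_of_mem_ends_stalk hue).1
    have hv := (val_of_mem_ends_stalk hve).2
    omega

theorem grounded_stalk_of_le {h k : ℕ} {S : Set (stalk h).E} (hS : stalkSet h k ⊆ S) {v : ℕ}
    (hv : v < h + 1) (hvk : v ≤ k) : (stalk h).Grounded S (⟨v, hv⟩ : Fin (h + 1)) := by
  induction v with
  | zero => exact .base rfl
  | succ v ih =>
    have hvh : v < h := by omega
    exact .step (e := (⟨v, hvh⟩ : Fin h)) (hS (show v < k by omega)) rfl
      (ih (by omega) (by omega))

theorem prune_stalk {h k : ℕ} {j : Fin h} (hj : j.1 < k) :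
    (stalk h).prune (stalkSet h k \ {j}) = stalkSet h j.1 := by
  ext e
  constructor
  · rintro ⟨he, w, hw, hg⟩
    have hlt : Fin.val (n := h + 1) w ≤ j.1 :=
      hg.le_of_stalk fun e he hej => he.2 (Fin.ext hej)
    exact ((val_of_mem_ends_stalk hw).1.trans hlt).lt_of_ne fun hej => he.2 (Fin.ext hej)
  · intro he
    have hej : Fin.val (n := h) e < j.1 := he
    have hsub : stalkSet h j.1 ⊆ stalkSet h k \ {j} := fun i hi =>
      ⟨lt_trans hi hj, fun h' => (ne_of_lt hi) (congrArg (Fin.val (n := h)) h')⟩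
    exact ⟨hsub he, _, Sym2.mem_mk_left .., grounded_stalk_of_le hsub _ hej.le⟩

theorem prune_stalkSet (h k : ℕ) : (stalk h).prune (stalkSet h k) = stalkSet h k :=
  (prune_subset _).antisymm fun _ he =>
    ⟨he, _, Sym2.mem_mk_left .., grounded_stalk_of_le subset_rfl _ (le_of_lt he)⟩

theorem realizes_stalk (h : ℕ) : Realizes (stalk h).toGame {.stalk h} := by
  refine ⟨fun K Z => ∃ k ≤ h, K = (stalk h).gameOn (stalkSet h k) ∧ Z = {.stalk k},
    ⟨?_, ?_⟩, h, le_rfl, ?_, rfl⟩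
  · rintro p _ K' _ ⟨k, hk, rfl, rfl⟩ hK
    obtain ⟨e, he, -, rfl⟩ := isOption_gameOn.1 hK
    exact ⟨_, move_singleton_iff.2 ⟨_, rfl, .stalk he⟩, _, (Fin.is_lt (n := h) e).le,
      congrArg _ (prune_stalk he), rfl⟩
  · rintro p _ _ Z ⟨k, hk, rfl, rfl⟩ hZ
    obtain ⟨c', rfl, hc⟩ := move_singleton_iff.1 hZ
    cases hc with
    | @stalk _ j hj =>
      refine ⟨_, isOption_gameOn.2 ⟨(⟨j, hj.trans_le hk⟩ : Fin h), hj, ?_, rfl⟩, j,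
        (hj.trans_le hk).le, congrArg _ (prune_stalk (j := ⟨j, hj.trans_le hk⟩) hj), rfl⟩
      cases p <;> exact EdgeColor.noConfusion
  · have hu : (Set.univ : Set (stalk h).E) = stalkSet h h :=
      (Set.eq_univ_of_forall fun i => Fin.is_lt (n := h) i).symm
    rw [toGame, hu, prune_stalkSet]

/-! ### Generalized Sprigs -/

section sprig

variable {B : Hackenbush} {S : Set B.E}

/-- The stem of a Generalized Sprig together with some edges of the blossom. -/
def sprigSet (S : Set B.E) : Set B.sprig.E := {e | e.elim True (· ∈ S)}

theorem sprigVertex_of_mem {v : B.V} (hv : v ∈ B.ground) : B.sprigVertex v = .top := if_pos hv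

theorem sprigVertex_ne_root (v : B.V) : B.sprigVertex v ≠ .root := by
  unfold sprigVertex
  split_ifs <;> simp

theorem mem_ground_of_sprigVertex_eq_top {v : B.V} (h : B.sprigVertex v = .top) :
    v ∈ B.ground := by
  by_contra hv
  simp [sprigVertex, hv] at h

theorem eq_or_mem_of_sprigVertex_eq {v w : B.V} (h : B.sprigVertex v = B.sprigVertex w) :
    v = w ∨ v ∈ B.ground := by
  by_cases hv : v ∈ B.ground
  · exact .inr hv
  · unfold sprigVertex at h
    rw [if_neg hv] at h
    split_ifs at h
    exact .inl (SprigVertex.inner.inj h)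

/-- While the stem stands, its top plays the part of the blossom's ground. All ground vertices are
merged into the top, so two distinct vertices can coincide only if they are grounded anyway. -/
theorem grounded_sprigSet {v : B.V} :
    B.sprig.Grounded (sprigSet S) (B.sprigVertex v) ↔ B.Grounded S v := by
  constructor
  · suffices H : ∀ w, B.sprig.Grounded (sprigSet S) w → ∀ v, B.sprigVertex v = w →
      B.Grounded S v from fun h => H _ h v rfl
    intro w hw
    induction hw with
    | base hw =>
      intro v hv
      exact absurd (hv.trans hw) (sprigVertex_ne_root v)
    | @step u w e he huw _ ih =>
      rintro v rfl
      have hue : u ∈ B.sprig.ends e := huw ▸ Sym2.mem_mk_left ..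
      have hve : B.sprigVertex v ∈ B.sprig.ends e := huw ▸ Sym2.mem_mk_right ..
      rcases e with _ | e
      · rcases Sym2.mem_iff.1 hve with h | h
        · exact absurd h (sprigVertex_ne_root v)
        · exact .base (mem_ground_of_sprigVertex_eq_top h)
      · obtain ⟨a, ha, rfl⟩ := Sym2.mem_map.1 hue
        obtain ⟨b, hb, hbv⟩ := Sym2.mem_map.1 hve
        rcases eq_or_mem_of_sprigVertex_eq hbv.symm with rfl | hv
        · exact (ih a rfl).of_mem he ha hb
        · exact .base hv
  · intro h
    induction h with
    | base hv =>
      rw [sprigVertex_of_mem hv]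
      exact .step (e := (none : Option B.E)) trivial rfl (.base rfl)
    | @step u v e he huv _ ih =>
      refine .step (e := some e) he ?_ ih
      change (B.ends e).map B.sprigVertex = _
      rw [huv]
      rfl

theorem prune_sprigSet : B.sprig.prune (sprigSet S) = sprigSet (B.prune S) := by
  ext e
  rcases e with _ | e
  · exact ⟨fun _ => trivial, fun _ => ⟨trivial, .root, Sym2.mem_mk_left .., .base rfl⟩⟩
  · refine and_congr Iff.rfl ⟨?_, ?_⟩
    · rintro ⟨w, hw, hg⟩
      obtain ⟨v, hv, rfl⟩ := Sym2.mem_map.1 hw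
      exact ⟨v, hv, grounded_sprigSet.1 hg⟩
    · rintro ⟨v, hv, hg⟩
      exact ⟨_, Sym2.mem_map.2 ⟨v, hv, rfl⟩, grounded_sprigSet.2 hg⟩

theorem prune_sprig_of_notMem {T : Set B.sprig.E} (hT : (none : Option B.E) ∉ T) :
    B.sprig.prune T = ∅ := by
  have key : ∀ w, B.sprig.Grounded T w → w = .root := by
    intro w hw
    induction hw with
    | base hw => exact hw
    | @step u w e he huw _ ih =>
      rcases e with _ | e
      · exact absurd he hT
      · have hue : u ∈ B.sprig.ends (some e) := by simp [huw]
        obtain ⟨a, -, rfl⟩ := Sym2.mem_map.1 hue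
        exact absurd ih (sprigVertex_ne_root a)
  refine Set.eq_empty_of_forall_notMem ?_
  rintro (_ | e) ⟨he, w, hw, hg⟩
  · exact hT he
  · obtain ⟨a, -, rfl⟩ := Sym2.mem_map.1 hw
    exact sprigVertex_ne_root a (key _ hg)

theorem prune_sprigSet_diff_some (e : B.E) :
    B.sprig.prune (sprigSet S \ {some e}) = sprigSet (B.prune (S \ {e})) := by
  rw [← prune_sprigSet]
  congr 1
  ext f
  rcases f with _ | f
  · exact and_iff_left (Option.some_ne_none e).symm
  · exact and_congr Iff.rfl (not_congr (Option.some_injective _).eq_iff)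

theorem prune_sprigSet_diff_none : B.sprig.prune (sprigSet S \ {none}) = ∅ :=
  prune_sprig_of_notMem fun h => h.2 rfl

theorem realizes_sprig (hB : B.IsRedBlue) :
    Realizes B.sprig.toGame {.sprig ⟨B.toGame, hB.isNumber_toGame⟩} := by
  -- Either the stem stands with a pruned blossom, or it has been cut and everything has fallen,
  -- which matches the Stalk of height 0.
  refine ⟨fun K Z => (∃ (S : Set B.E) (hS : B.prune S = S), K = B.sprig.gameOn (sprigSet S) ∧
    Z = {.sprig ⟨B.gameOn S, hB.isNumber_gameOn hS⟩}) ∨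
    (K = B.sprig.gameOn ∅ ∧ Z = {.stalk 0}), ⟨?_, ?_⟩, ?_⟩
  · rintro p _ K' _ (⟨S, hS, rfl, rfl⟩ | ⟨rfl, rfl⟩) hK
    · obtain ⟨_ | e, he, hc, rfl⟩ := isOption_gameOn.1 hK
      · exact ⟨_, move_singleton_iff.2 ⟨_, rfl, .cut _⟩,
          .inr ⟨congrArg _ prune_sprigSet_diff_none, rfl⟩⟩
      · refine ⟨_, move_singleton_iff.2 ⟨_, rfl, .blossom (B' := ⟨B.gameOn (B.prune (S \ {e})),
          hB.isNumber_gameOn (prune_prune _)⟩) (isOption_gameOn.2 ⟨e, he, hc, rfl⟩)⟩,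
          .inl ⟨_, prune_prune _, congrArg _ (prune_sprigSet_diff_some e), rfl⟩⟩
    · obtain ⟨e, he, -⟩ := isOption_gameOn.1 hK
      exact absurd he (Set.notMem_empty e)
  · rintro p _ _ Z (⟨S, hS, rfl, rfl⟩ | ⟨rfl, rfl⟩) hZ
    · obtain ⟨c', rfl, hc⟩ := move_singleton_iff.1 hZ
      cases hc with
      | cut =>
        refine ⟨_, isOption_gameOn.2 ⟨(none : Option B.E), trivial, ?_, rfl⟩,
          .inr ⟨congrArg _ prune_sprigSet_diff_none, rfl⟩⟩
        cases p <;> exact EdgeColor.noConfusion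
      | @blossom _ B' h =>
        obtain ⟨B', hB'⟩ := B'
        obtain ⟨e, he, hc, rfl⟩ := isOption_gameOn.1 h
        exact ⟨_, isOption_gameOn.2 ⟨some e, he, hc, rfl⟩,
          .inl ⟨_, prune_prune _, congrArg _ (prune_sprigSet_diff_some e), rfl⟩⟩
    · obtain ⟨c', rfl, hc⟩ := move_singleton_iff.1 hZ
      cases hc with
      | stalk hk => exact absurd hk (Nat.not_lt_zero _)
  · refine .inl ⟨_, prune_prune Set.univ, ?_, rfl⟩
    rw [toGame, ← prune_sprigSet]
    congr 2
    ext e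
    rcases e with _ | e <;> exact ⟨fun _ => trivial, fun _ => trivial⟩

end sprig

end Hackenbush

open Advantage Component SumPosition

/-! ### The edge -/

namespace Advantage

/-- The total weight of a list of values. -/
noncomputable def listWeight (x : List ℚ) : Lex (ℚ →₀ ℤ) := (x.map weight).sum

theorem deg_listWeight {x : List ℚ} (hx : ∀ v ∈ x, 0 < v) : deg (listWeight x) = x.length := by
  induction x with
  | nil => simp [listWeight]
  | cons v x ih =>
    rw [List.forall_mem_cons] at hx
    have h := ih hx.2
    simp only [listWeight, List.map_cons, List.sum_cons, map_add, deg_weight_of_pos hx.1,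
      List.length_cons] at h ⊢
    rw [h]
    push_cast
    ring

theorem listWeight_pos {x : List ℚ} (hx : ∀ v ∈ x, 0 < v) (hne : x ≠ []) : 0 < listWeight x :=
  List.sum_pos _ (by simpa using fun v hv => weight_pos (hx v hv)) (by simpa using hne)

theorem listWeight_lt_weight {y : List ℚ} {v : ℚ} (hv : 0 < v) (hy : ∀ w ∈ y, v < w) :
    listWeight y < weight v := by
  have key : ∀ j ≤ v, ofLex (listWeight y) j = 0 := by
    intro j hj
    induction y with
    | nil => rfl
    | cons w y ih =>
      rw [List.forall_mem_cons] at hy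
      have h := ih hy.2
      simp only [listWeight, List.map_cons, List.sum_cons, ofLex_add, Finsupp.add_apply] at h ⊢
      rw [h, weight_of_pos (hv.trans hy.1)]
      simp [(hj.trans_lt hy.1).ne]
  rw [Finsupp.Lex.lt_iff, weight_of_pos hv]
  exact ⟨v, fun j hj => by simp [key j hj.le, hj.ne], by simp [key v le_rfl]⟩

theorem listWeight_lt_listWeight {x y : List ℚ} {v : ℚ} (hx : ∀ w ∈ x, 0 < w) (hv : v ∈ x)
    (hy : ∀ w ∈ y, v < w) : listWeight y < listWeight x := by
  refine (listWeight_lt_weight (hx v hv) hy).trans_le (List.single_le_sum ?_ _ ?_)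
  · simpa using fun w hw => (weight_pos (hx w hw)).le
  · simpa using ⟨v, hv, rfl⟩

/-- The common part of the two lists has the same weight on both sides, so cancelling pairs does not
affect the total. -/
theorem listWeight_diff (x y : List ℚ) :
    listWeight (x.diff y) - listWeight (y.diff x) = listWeight x - listWeight y := by
  have h (x y : List ℚ) : listWeight x =
      listWeight (x.diff y) + (((x : Multiset ℚ) ∩ y).map weight).sum := by
    have h1 (l : List ℚ) : listWeight l = ((l : Multiset ℚ).map weight).sum := by
      simp [listWeight]
    rw [h1, h1, ← Multiset.coe_sub, ← Multiset.sum_add, ← Multiset.map_add, Multiset.sub_add_inter]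
  rw [h x y, h y x, Multiset.inter_comm (y : Multiset ℚ)]
  simp

theorem notMem_diff_of_mem_diff {x y : List ℚ} {v : ℚ} (h : v ∈ x.diff y) : v ∉ y.diff x := by
  intro h'
  rw [← Multiset.mem_coe, ← Multiset.coe_sub, ← Multiset.count_pos, Multiset.count_sub] at h h'
  omega

/-- The sign of the edge determines the sign of the total. -/
theorem edge_cases {x y : List ℚ} (hx : ∀ v ∈ x, 0 < v) (hy : ∀ v ∈ y, 0 < v) :
    (edge x y = 0 ∧ (listWeight x - listWeight y = 0 ∨
      (0 < deg (listWeight x - listWeight y) ∧ 0 < listWeight x - listWeight y) ∨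
      (deg (listWeight x - listWeight y) < 0 ∧ listWeight x - listWeight y < 0))) ∨
    (0 < edge x y ∧ listWeight x - listWeight y < 0) ∨
    (edge x y < 0 ∧ 0 < listWeight x - listWeight y) := by
  rw [← listWeight_diff, edge]
  have hx' : ∀ v ∈ x.diff y, 0 < v := fun v hv => hx v ((List.diff_subset _ _) hv)
  have hy' : ∀ v ∈ y.diff x, 0 < v := fun v hv => hy v ((List.diff_subset _ _) hv)
  have hdisj : ∀ v ∈ x.diff y, v ∉ y.diff x := fun v => notMem_diff_of_mem_diff
  clear hx hy
  generalize x.diff y = x', y.diff x = y' at *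
  clear x y
  rename' x' => x, y' => y
  have hl0 : listWeight [] = 0 := rfl
  rcases eq_or_ne x [] with rfl | hxn
  · refine .inl ⟨rfl, ?_⟩
    rcases eq_or_ne y [] with rfl | hyn
    · exact .inl (sub_self _)
    · refine .inr (.inr ⟨?_, ?_⟩)
      · have := List.length_pos_of_ne_nil hyn
        rw [hl0, zero_sub, map_neg, deg_listWeight hy']
        omega
      · rw [hl0, zero_sub, neg_lt_zero]
        exact listWeight_pos hy' hyn
  · obtain ⟨a, ha⟩ := Option.ne_none_iff_exists'.1 (mt List.min?_eq_none_iff.1 hxn)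
    rcases eq_or_ne y [] with rfl | hyn
    · refine .inl ⟨by simp [minDiff, ha], .inr (.inl ⟨?_, ?_⟩)⟩
      · have := List.length_pos_of_ne_nil hxn
        rw [hl0, sub_zero, deg_listWeight hx']
        omega
      · rw [hl0, sub_zero]
        exact listWeight_pos hx' hxn
    · obtain ⟨b, hb⟩ := Option.ne_none_iff_exists'.1 (mt List.min?_eq_none_iff.1 hyn)
      simp only [minDiff, ha, hb, sub_pos, sub_neg]
      rw [List.min?_eq_some_iff] at ha hb
      -- The list with the smaller minimum is the heavier one; equal minima would be a pair left
      -- uncancelled.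
      rcases lt_trichotomy a b with hab | rfl | hab
      · exact .inr (.inr ⟨hab, listWeight_lt_listWeight hx' ha.1 fun w hw =>
          hab.trans_le (hb.2 w hw)⟩)
      · exact absurd hb.1 (hdisj a ha.1)
      · exact .inr (.inl ⟨hab, listWeight_lt_listWeight hy' hb.1 fun w hw =>
          hab.trans_le (ha.2 w hw)⟩)

end Advantage

/-! ### Outcomes of sums of Generalized Sprigs and Stalks -/

namespace Summand

open scoped Classical in
/-- The component played by a summand with a red-blue blossom. -/
noncomputable def component : Summand → Component
  | sprig B => if h : B.IsRedBlue then .sprig ⟨B.toGame, h.isNumber_toGame⟩ else .stalk 0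
  | stalk h => .stalk h

theorem realizes_position {s : Summand} (h : ∀ B, s = sprig B → B.IsRedBlue) :
    Realizes s.position.toGame {s.component} := by
  cases s with
  | sprig B =>
    rw [component, dif_pos (h B rfl)]
    exact Hackenbush.realizes_sprig (h B rfl)
  | stalk k => exact Hackenbush.realizes_stalk k

/-- The components of a list of summands. -/
noncomputable def components (l : List Summand) : Multiset Component := ↑(l.map component)

theorem realizes_total {l : List Summand} (h : ∀ B, sprig B ∈ l → B.IsRedBlue) :
    Realizes (total l).toGame (components l) := by
  induction l with
  | nil => exact Hackenbush.realizes_empty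
  | cons s l ih =>
    exact Hackenbush.realizes_add (realizes_position fun B hB => h B (by simp [hB]))
      (ih fun B hB => h B (by simp [hB]))

theorem two_le_heap_component {s : Summand} : 2 ≤ s.component.heap ↔ 2 ≤ s.height := by
  cases s with
  | sprig B =>
    simp only [component, height]
    split_ifs with h <;> simp only [Component.heap]
    · split_ifs <;> simp
    · simp
  | stalk h => rfl

theorem exists_two_le_heaps {l : List Summand} :
    (∃ h ∈ heaps (components l), 2 ≤ h) ↔ ∃ s ∈ l, 2 ≤ s.height := by
  simp [heaps, components, two_le_heap_component]

/-- A position of the evil twin, with the same totals and with misère nim value equal to the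
nim-sum of the heaps. -/
theorem exists_realizes_evilTwin {l : List Summand} (h : ∀ B, sprig B ∈ l → B.IsRedBlue) :
    ∃ X, Realizes (evilTwin l).toGame X ∧
      (∀ p, SumPosition.total p X = SumPosition.total p (components l)) ∧
      Convention.misere.nim (heaps X) = Convention.normal.nim (heaps (components l)) := by
  rw [evilTwin]
  split_ifs with hl
  · exact ⟨_, realizes_total h, fun _ => rfl,
      Convention.nim_misere_of_exists (exists_two_le_heaps.2 hl)⟩
  · refine ⟨_, Hackenbush.realizes_add (realizes_total h) (Hackenbush.realizes_stalk 1),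
      fun p => ?_, ?_⟩
    · rw [add_comm, Multiset.singleton_add, SumPosition.total_cons]
      simp [Component.signedValue]
    · rw [← exists_two_le_heaps] at hl
      push Not at hl
      have h1 : (Component.stalk 1).heap = 1 := rfl
      rw [add_comm, Multiset.singleton_add, heaps_cons, h1, Convention.nim_misere_of_forall
        (Multiset.forall_mem_cons.2 ⟨one_lt_two, hl⟩), xorSum_cons]
      change 1 ^^^ xorSum _ ^^^ 1 = xorSum _
      rw [Nat.xor_comm 1, Nat.xor_assoc]
      simp

theorem normalOutcome_total {l : List Summand} (h : ∀ B, sprig B ∈ l → B.IsRedBlue) :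
    (total l).toGame.normalOutcome = Outcome.ofWinners
      (¬ MoverLoses (-SumPosition.total .right (components l)) (xorSum (heaps (components l))))
      (¬ MoverLoses (SumPosition.total .right (components l)) (xorSum (heaps (components l)))) := by
  have hX := (realizes_total h).normalWinsFirst_iff
  rw [CGame.normalOutcome, hX .left, hX .right, ← total_other]
  rfl

theorem misereOutcome_evilTwin {l : List Summand} (h : ∀ B, sprig B ∈ l → B.IsRedBlue) :
    (evilTwin l).toGame.misereOutcome = (total l).toGame.normalOutcome := by
  obtain ⟨X, hX, ht, hn⟩ := exists_realizes_evilTwin h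
  have hX := hX.misereWinsFirst_iff
  have hY := (realizes_total h).normalWinsFirst_iff
  rw [CGame.misereOutcome, CGame.normalOutcome, hX .left, hX .right, hY .left, hY .right, ht, ht,
    hn]

end Summand

theorem xorSum_coe (l : List ℕ) : xorSum l = nimSum l := rfl

theorem nimSum_append_of_forall_eq_zero {l l' : List ℕ} (h : ∀ x ∈ l, x = 0) :
    nimSum (l ++ l') = nimSum l' := by
  induction l with
  | nil => rfl
  | cons x l ih =>
    rw [List.forall_mem_cons] at h
    rw [← ih h.2, h.1]
    exact Nat.zero_xor _

section sprigsAndStalks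

variable {Bs Cs : List Hackenbush} {hs : List ℕ}

theorem heap_component_of_value_ne_zero {B : Hackenbush} (hB : B.value ≠ 0) :
    (Summand.sprig B).component.heap = 0 := by
  rw [Summand.component]
  split_ifs
  · exact if_neg hB
  · rfl

theorem xorSum_heaps_sprigsAndStalks (hBs : ∀ B ∈ Bs, B.value ≠ 0) (hCs : ∀ C ∈ Cs, C.value ≠ 0) :
    xorSum (heaps (Summand.components (sprigsAndStalks Bs Cs hs))) = nimSum hs := by
  have hstalk : ((fun s : Summand => s.component.heap) ∘ Summand.stalk) = id := rfl
  rw [heaps, Summand.components, Multiset.map_coe, xorSum_coe, List.map_map, sprigsAndStalks,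
    List.map_append, nimSum_append_of_forall_eq_zero, List.map_map]
  · exact congrArg nimSum (List.map_id hs)
  · simp only [List.mem_map, List.mem_append]
    rintro _ ⟨_, ⟨B, hB, rfl⟩ | ⟨C, hC, rfl⟩, rfl⟩
    · exact heap_component_of_value_ne_zero (hBs B hB)
    · exact heap_component_of_value_ne_zero (hCs C hC)

/-- Right's total is used because his sign is `1`: blue Sprigs count positively, and the degree
becomes Δ. -/
theorem total_sprigsAndStalks (hBs : ∀ B ∈ Bs, B.IsRedBlue) (hCs : ∀ C ∈ Cs, C.IsRedBlue) :
    total .right (Summand.components (sprigsAndStalks Bs Cs hs)) =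
      listWeight (Bs.map fun B => B.value) - listWeight (Cs.map fun C => -C.value) := by
  have hsprig {l : List Hackenbush} (h : ∀ B ∈ l, B.IsRedBlue) :
      l.map (fun B => weight ((Summand.sprig B).component.signedValue .right)) =
        l.map fun B => weight B.value := by
    refine List.map_congr_left fun B hB => ?_
    rw [Summand.component, dif_pos (h B hB)]
    simp [signedValue, CGame.signedValue, Player.sign, Hackenbush.value]
  have hneg : listWeight (Cs.map fun C => -C.value) = -(Cs.map fun C => weight C.value).sum := by
    clear hCs
    induction Cs with
    | nil => simp [listWeight]
    | cons C Cs ih =>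
      simp only [listWeight, List.map_cons, List.sum_cons, weight_neg, neg_add] at ih ⊢
      rw [ih]
  rw [hneg, sub_neg_eq_add]
  simp only [total, Summand.components, Multiset.map_coe, Multiset.sum_coe, sprigsAndStalks,
    List.map_append, List.sum_append, List.map_map, Function.comp_def, hsprig hBs, hsprig hCs,
    listWeight]
  simp [Summand.component, signedValue]

end sprigsAndStalks

theorem theorem4p6
    -- the blossoms of the blue Generalized Sprigs, those of the red ones, and the Stalk heights
    (Bs Cs : List Hackenbush) (hs : List ℕ)
    (hBs : ∀ B ∈ Bs, B.IsRedBlue ∧ 0 < B.value)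
    (hCs : ∀ C ∈ Cs, C.IsRedBlue ∧ C.value < 0)
    (hhs : ∀ h ∈ hs, 1 ≤ h)
    -- `G = ∑ *:(x_i) + ∑ *:(-y_j) + A`
    (G : List Summand) (hG : G = sprigsAndStalks Bs Cs hs)
    -- the advantage, the edge and the nim-sum of the Stalks
    (Δ : ℤ) (hΔ : Δ = (Bs.length : ℤ) - (Cs.length : ℤ))
    (ε : ℚ) (hε : ε = edge (Bs.map fun B => B.value) (Cs.map fun C => -C.value))
    (a : ℕ) (ha : a = nimSum hs) :
    (Summand.total G).toGame.normalOutcome = (Summand.evilTwin G).toGame.misereOutcome ∧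
    -- (i)
    (2 ≤ Δ → (Summand.total G).toGame.normalOutcome = Outcome.L) ∧
    (Δ ≤ -2 → (Summand.total G).toGame.normalOutcome = Outcome.R) ∧
    -- (ii)
    ((Δ = 1 ∧ ε ≤ 0 ∧ a = 0) ∨ (Δ = -1 ∧ 0 ≤ ε ∧ a = 0) →
      (Summand.total G).toGame.normalOutcome = Outcome.N) ∧
    ((Δ = 1 ∧ 0 < ε ∧ a = 0) ∨ (Δ = 1 ∧ a ≠ 0) →
      (Summand.total G).toGame.normalOutcome = Outcome.L) ∧
    ((Δ = -1 ∧ ε < 0 ∧ a = 0) ∨ (Δ = -1 ∧ a ≠ 0) →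
      (Summand.total G).toGame.normalOutcome = Outcome.R) ∧
    -- (iii)
    (Δ = 0 ∧ a ≠ 0 → (Summand.total G).toGame.normalOutcome = Outcome.N) ∧
    (Δ = 0 ∧ ε = 0 ∧ a = 0 → (Summand.total G).toGame.normalOutcome = Outcome.P) ∧
    (Δ = 0 ∧ 0 < ε ∧ a = 0 → (Summand.total G).toGame.normalOutcome = Outcome.L) ∧
    (Δ = 0 ∧ ε < 0 ∧ a = 0 → (Summand.total G).toGame.normalOutcome = Outcome.R) := by 
  have hrb : ∀ B, Summand.sprig B ∈ G → B.IsRedBlue := by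
    subst hG
    intro B hB
    simp only [sprigsAndStalks, List.mem_append, List.mem_map] at hB
    rcases hB with (⟨B', hB', h⟩ | ⟨B', hB', h⟩) | ⟨_, _, h⟩
    · cases h
      exact (hBs _ hB').1
    · cases h
      exact (hCs _ hB').1
    · cases h
  refine ⟨(Summand.misereOutcome_evilTwin hrb).symm, ?_⟩
  have hx : ∀ v ∈ Bs.map fun B => B.value, 0 < v := by
    simpa using fun B hB => (hBs B hB).2
  have hy : ∀ v ∈ Cs.map fun C => -C.value, 0 < v := by
    simpa using fun C hC => (hCs C hC).2
  have hedge := edge_cases hx hy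
  have hdeg : deg (listWeight (Bs.map fun B => B.value) -
      listWeight (Cs.map fun C => -C.value)) = Δ := by
    rw [map_sub, deg_listWeight hx, deg_listWeight hy, hΔ, List.length_map, List.length_map]
  have hout := Summand.normalOutcome_total hrb
  rw [hG, total_sprigsAndStalks (fun B hB => (hBs B hB).1) (fun C hC => (hCs C hC).1),
    xorSum_heaps_sprigsAndStalks (fun B hB => (hBs B hB).2.ne') (fun C hC => (hCs C hC).2.ne),
    ← ha, ← hG] at hout
  rw [← hε] at hedge
  generalize listWeight (Bs.map fun B => B.value) -
    listWeight (Cs.map fun C => -C.value) = c at hedge hdeg hout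
  rw [hdeg] at hedge
  have hR : MoverLoses c a ↔ 2 ≤ Δ ∨ (Δ = 1 ∧ (a ≠ 0 ∨ c < 0)) ∨ (Δ = 0 ∧ a = 0 ∧ c ≤ 0) := by
    rw [MoverLoses, hdeg]
  have hL : MoverLoses (-c) a ↔
      Δ ≤ -2 ∨ (Δ = -1 ∧ (a ≠ 0 ∨ 0 < c)) ∨ (Δ = 0 ∧ a = 0 ∧ 0 ≤ c) := by
    rw [MoverLoses, map_neg, hdeg, neg_lt_zero, neg_nonpos, le_neg, neg_eq_iff_eq_neg, neg_eq_zero]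
  have outN (h1 : ¬ MoverLoses (-c) a) (h2 : ¬ MoverLoses c a) :
      (Summand.total G).toGame.normalOutcome = Outcome.N := by simp [hout, Outcome.ofWinners, h1, h2]
  have outL (h1 : ¬ MoverLoses (-c) a) (h2 : MoverLoses c a) :
      (Summand.total G).toGame.normalOutcome = Outcome.L := by simp [hout, Outcome.ofWinners, h1, h2]
  have outR (h1 : MoverLoses (-c) a) (h2 : ¬ MoverLoses c a) :
      (Summand.total G).toGame.normalOutcome = Outcome.R := by simp [hout, Outcome.ofWinners, h1, h2]
  have outP (h1 : MoverLoses (-c) a) (h2 : MoverLoses c a) :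
      (Summand.total G).toGame.normalOutcome = Outcome.P := by simp [hout, Outcome.ofWinners, h1, h2]
  rw [hL, hR] at outN outL outR outP
  -- The sign alternatives of `c` and ε are spelled out, so that the clauses follow from
  -- `edge_cases` by propositional reasoning and arithmetic on Δ. When ε is 0 because one side is
  -- empty, the sign of Δ fixes that of `c`.
  have hcpos : 0 < c → ¬ c ≤ 0 ∧ ¬ c < 0 ∧ 0 ≤ c := fun h => ⟨h.not_ge, h.not_gt, h.le⟩
  have hcneg : c < 0 → ¬ 0 ≤ c ∧ ¬ 0 < c ∧ c ≤ 0 := fun h => ⟨h.not_ge, h.not_gt, h.le⟩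
  have hczero : c = 0 → c ≤ 0 ∧ 0 ≤ c ∧ ¬ c < 0 ∧ ¬ 0 < c := by
    rintro rfl
    simp
  have hε1 : 0 < ε → ¬ ε ≤ 0 ∧ ε ≠ 0 ∧ ¬ ε < 0 := fun h => ⟨h.not_ge, h.ne', h.not_gt⟩
  have hε2 : ε < 0 → ¬ 0 ≤ ε ∧ ε ≠ 0 ∧ ¬ 0 < ε := fun h => ⟨h.not_ge, h.ne, h.not_gt⟩
  have hε3 : ε = 0 → ¬ 0 < ε ∧ ¬ ε < 0 := by
    rintro rfl
    simp
  refine ⟨fun h => outL ?_ ?_, fun h => outR ?_ ?_, fun h => outN ?_ ?_, fun h => outL ?_ ?_,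
    fun h => outR ?_ ?_, fun h => outN ?_ ?_, fun h => outP ?_ ?_, fun h => outL ?_ ?_,
    fun h => outR ?_ ?_⟩ <;> clear outN outL outR outP hout hL hR hx hy hrb <;> lia
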